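/- A set $X\subset\mathbb R^n$ is a \emph{kissing configuration} if $\|x\|=2$ for all $x\in X$ and $\|x-y\|\ge 2$ for all distinct $x,y\in X$; equivalently, $X$ is the set of centers of pairwise non-overlapping unit spheres that all touch the unit sphere centered at the origin. Let the \emph{kissing number} $k(n)$ be the largest cardinality of a kissing configuration in $\mathbb R^n$. For a lattice $L\subset\mathbb R^n$ (the $\mathbb Z$-span of an $\mathbb R$-basis of $\mathbb R^n$), let $\lambda_1(L)$ be the length of the shortest nonzero vectors of $L$; the vectors of $L$ of this length are its \emph{minimal vectors}. Let the \emph{lattice kissing number} $k^{(L)}(n)$ be the largest cardinality of a kissing configuration in $\mathbb R^n$ contained in some lattice $L$ with $\lambda_1(L)=2$. Let $E_8\subset\mathbb R^8$ be the lattice of all points whose coordinates are all integers or all elements of $\mathbb Z+\frac12$, and whose coordinate sum is an even integer. Let $\Lambda_{24}\subset\mathbb R^{24}$ be the Leech lattice: the set of all $z/\sqrt8$ with $z\in\mathbb Z^{24}$ such that, for some $m\in\mathbb Z$, all $z_i\equiv m \pmod 2$, the word $\bigl((z_i-m)/2 \bmod 2\bigr)_i$ lies in the extended binary Golay code, and $\sum_i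 z_i\equiv 4m\pmod 8$. Here the extended binary Golay code is the subspace of $\mathbb F_2^{24}$ spanned by the 12 words ($0\le k\le 11$) whose first 23 coordinates are the coefficients of $X^0,\dots,X^{22}$ in $X^k(1+X^2+X^4+X^5+X^6+X^{10}+X^{11})$ and whose last coordinate is $1$. \textbf{Theorem.} (1) $k(8)=k^{(L)}(8)=240$, attained on $E_8$: one has $\lambda_1(E_8)=\sqrt2$, there are exactly $240$ minimal vectors in $E_8$, and the rescaled lattice $\sqrt2\,E_8$ has $\lambda_1(\sqrt2\,E_8)=2$ and its minimal vectors form a kissing configuration of cardinality $240$. (2) $k(24)=k^{(L)}(24)=196560$, attained on $\Lambda_{24}$: $\Lambda_{24}$ is a lattice with $\lambda_1(\Lambda_{24})=2$, and its minimal vectors form a kissing configuration of cardinality $196560$. -/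

import Mathlib

open scoped Pointwise

/-- Euclidean space `ℝⁿ`. -/
abbrev Euc (n : ℕ) : Type := EuclideanSpace ℝ (Fin n)

/-- `X` is the set of centres of a family of pairwise non-overlapping unit spheres in `ℝⁿ`, all of
which touch (externally) the unit sphere centred at the origin. -/
def IsKissingConfiguration {n : ℕ} (X : Set (Euc n)) : Prop :=
  (∀ x ∈ X, dist x 0 = 2) ∧ ∀ x ∈ X, ∀ y ∈ X, x ≠ y → 2 ≤ dist x y

/-- The kissing number `k(n)`: the largest number of non-overlapping unit spheres that a unit
sphere in `ℝⁿ` can touch simultaneously (as an extended natural number, so that the supremum has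
no default value). -/
noncomputable def kissingNumber (n : ℕ) : ℕ∞ :=
  ⨆ (X : Set (Euc n)) (_ : IsKissingConfiguration X), X.encard

/-- `L` is a (full rank) lattice in `ℝⁿ`: a discrete subgroup that spans `ℝⁿ`. -/
def IsLatticeIn {n : ℕ} (L : Submodule ℤ (Euc n)) : Prop :=
  ∃ _ : DiscreteTopology L, IsZLattice ℝ L

/-- `λ₁(L) = r`: the shortest nonzero vectors of `L` have length `r`. -/
def HasLeastLength {n : ℕ} (L : Submodule ℤ (Euc n)) (r : ℝ) : Prop :=
  IsLeast {s : ℝ | ∃ x ∈ L, x ≠ 0 ∧ ‖x‖ = s} r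

/-- The minimal vectors of `L`: its vectors of length `λ₁(L)`. -/
def minimalVectors {n : ℕ} (L : Submodule ℤ (Euc n)) : Set (Euc n) :=
  {x | x ∈ L ∧ HasLeastLength L ‖x‖}

/-- The lattice kissing number `k⁽ᴸ⁾(n)`: the largest number of non-overlapping unit spheres that
touch the unit sphere and whose centres all lie on one lattice `L` with `λ₁(L) = 2`. -/
noncomputable def latticeKissingNumber (n : ℕ) : ℕ∞ :=
  ⨆ (X : Set (Euc n)) (_ : IsKissingConfiguration X ∧
    ∃ L : Submodule ℤ (Euc n), IsLatticeIn L ∧ HasLeastLength L 2 ∧ X ⊆ L), X.encard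

/-- `L` is a lattice with `λ₁(L) = 2`, and the unit spheres centred at its minimal vectors are
`N` non-overlapping unit spheres touching the unit sphere. -/
def KissesWith {n : ℕ} (L : Submodule ℤ (Euc n)) (N : ℕ∞) : Prop :=
  IsLatticeIn L ∧ HasLeastLength L 2 ∧
    IsKissingConfiguration (minimalVectors L) ∧ (minimalVectors L).encard = N

/-- The `E₈` lattice: the points of `ℝ⁸` whose coordinates are all integers or all half-integers
(elements of `ℤ + 1/2`), and whose coordinate sum is an even integer. -/
noncomputable def latticeE8 : Submodule ℤ (Euc 8) where
  carrier := {x | ((∀ i, ∃ a : ℤ, x i = a) ∨ (∀ i, ∃ a : ℤ, x i = a + 1 / 2)) ∧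
    ∃ s : ℤ, ∑ i, x i = 2 * s}
  zero_mem' := ⟨Or.inl fun _ => ⟨0, by simp⟩, 0, by simp⟩
  add_mem' := by
    rintro x y ⟨hx, s, hs⟩ ⟨hy, t, ht⟩
    refine ⟨?_, s + t, ?_⟩
    · rcases hx with hx | hx <;> rcases hy with hy | hy
      · refine Or.inl fun i => ?_
        obtain ⟨a, ha⟩ := hx i
        obtain ⟨b, hb⟩ := hy i
        exact ⟨a + b, by simp [ha, hb]⟩
      · refine Or.inr fun i => ?_
        obtain ⟨a, ha⟩ := hx i
        obtain ⟨b, hb⟩ := hy i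
        exact ⟨a + b, by simp only [PiLp.add_apply, ha, hb]; push_cast; ring⟩
      · refine Or.inr fun i => ?_
        obtain ⟨a, ha⟩ := hx i
        obtain ⟨b, hb⟩ := hy i
        exact ⟨a + b, by simp only [PiLp.add_apply, ha, hb]; push_cast; ring⟩
      · refine Or.inl fun i => ?_
        obtain ⟨a, ha⟩ := hx i
        obtain ⟨b, hb⟩ := hy i
        exact ⟨a + b + 1, by simp only [PiLp.add_apply, ha, hb]; push_cast; ring⟩
    · simp only [PiLp.add_apply, Finset.sum_add_distrib, hs, ht]
      push_cast
      ring
  smul_mem' := by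
    rintro c x ⟨hx, s, hs⟩
    refine ⟨?_, c * s, ?_⟩
    · rcases hx with hx | hx
      · refine Or.inl fun i => ?_
        obtain ⟨a, ha⟩ := hx i
        exact ⟨c * a, by simp [ha]⟩
      · rcases Int.even_or_odd' c with ⟨d, hd | hd⟩
        · refine Or.inl fun i => ?_
          obtain ⟨a, ha⟩ := hx i
          exact ⟨c * a + d, by
            simp only [PiLp.smul_apply, ha, hd, zsmul_eq_mul]; push_cast; ring⟩
        · refine Or.inr fun i => ?_
          obtain ⟨a, ha⟩ := hx i
          exact ⟨c * a + d, by
            simp only [PiLp.smul_apply, ha, hd, zsmul_eq_mul]; push_cast; ring⟩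
    · simp only [PiLp.smul_apply, zsmul_eq_mul, ← Finset.mul_sum, hs]
      push_cast
      ring

/-- The rows of a generator matrix of the extended binary Golay code: the first 23 coordinates of
row `k` are the coefficients of `Xᵏ (1 + X² + X⁴ + X⁵ + X⁶ + X¹⁰ + X¹¹)`, a shift of the generator
polynomial of the cyclic binary Golay code, and the last coordinate is the parity bit. -/
def golayRow (k : Fin 12) : Fin 24 → ZMod 2 := fun i =>
  if i.val = 23 ∨ i.val ∈ [0, 2, 4, 5, 6, 10, 11].map (k.val + ·) then 1 else 0

/-- The extended binary Golay code, of length 24, dimension 12 and minimal distance 8. -/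
def golayCode : Submodule (ZMod 2) (Fin 24 → ZMod 2) :=
  Submodule.span (ZMod 2) (Set.range golayRow)

/-- The Leech lattice `Λ₂₄`: the vectors `z / √8`, where `z ∈ ℤ²⁴` is such that for some integer
`m` all `zᵢ` are congruent to `m` modulo 2, the reduction modulo 2 of the word `(zᵢ - m) / 2`
lies in the extended binary Golay code, and the sum of the `zᵢ` is congruent to `4m` modulo 8.
(As the all-one word is in the code, only the parity of `m` matters.) -/
noncomputable def leechLattice : Submodule ℤ (Euc 24) where
  carrier := {x | ∃ (m : ℤ) (w : Fin 24 → ℤ), (fun i => (w i : ZMod 2)) ∈ golayCode ∧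
    (∑ i, (m + 2 * w i)) ≡ 4 * m [ZMOD 8] ∧ ∀ i, √8 * x i = ((m + 2 * w i : ℤ) : ℝ)}
  zero_mem' := ⟨0, 0, by
    have h : (fun i : Fin 24 => (((0 : Fin 24 → ℤ) i : ℤ) : ZMod 2)) = 0 := by
      ext i; simp
    rw [h]; exact golayCode.zero_mem, by simp, by simp⟩
  add_mem' := by
    rintro x y ⟨m, w, hw, hs, hx⟩ ⟨m', w', hw', hs', hy⟩
    refine ⟨m + m', w + w', ?_, ?_, fun i => ?_⟩
    · have h := golayCode.add_mem hw hw'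
      convert h using 1
      ext i
      simp
    · have h := hs.add hs'
      rw [← Finset.sum_add_distrib] at h
      convert h using 1
      · refine Finset.sum_congr rfl fun i _ => ?_
        simp only [Pi.add_apply]
        ring
      · ring
    · have h1 := hx i
      have h2 := hy i
      simp only [PiLp.add_apply, Pi.add_apply, mul_add, h1, h2]
      push_cast
      ring
  smul_mem' := by
    rintro c x ⟨m, w, hw, hs, hx⟩
    refine ⟨c * m, fun i => c * w i, ?_, ?_, fun i => ?_⟩
    · have h := golayCode.smul_mem (c : ZMod 2) hw
      convert h using 1
      ext i
      simp
    · have h := hs.mul_left c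
      rw [Finset.mul_sum] at h
      convert h using 1
      · refine Finset.sum_congr rfl fun i _ => ?_
        ring
      · ring
    · have h1 := hx i
      simp only [PiLp.smul_apply, zsmul_eq_mul]
      rw [mul_left_comm, h1]
      push_cast
      ring

/-! Upper bounds come from Delsarte's linear programming method, lower bounds from counting minimal
vectors; the two meet exactly.

For the upper bound, the Gegenbauer polynomial `G_k` is a positive definite kernel on the sphere.
Under the Fischer product, multiplication by a variable is adjoint to differentiation, so
multiplication by `‖X‖²` is adjoint to the Laplacian, and `⟨x, X⟩ ^ k` reproduces evaluation at `x`
up to `k!`. Hence zonal harmonics satisfy `fischer (zonal k x) (zonal k y) = k! G_k(⟨x, y⟩)` on unit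
vectors (`fischer_zonal`), a Gram matrix. If `f = ∑ a_k G_k` with `a_k ≥ 0`, `a_0 > 0`, and `f ≤ 0`
on `[-1, 1/2]`, then summing `f(⟨x, y⟩)` over all pairs from a code `X` of minimal angle `π / 3`
gives `a_0 |X|² ≤ |X| f(1)`. In dimensions 8 and 24 there are polynomials for which `f(1) / a_0` is
exactly 240 and 196560.

For the lower bound, differences of distinct minimal vectors are nonzero lattice vectors, so minimal
vectors of a lattice with `λ₁ = 2` always kiss. Congruences modulo 2, 4 and 8 determine the shortest
vectors. For the Leech lattice the input about the Golay code is that its weights are divisible by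
4, that none lies strictly between 0 and 8, and that there are 4096 words and 759 octads; the
weights and the octads are checked by enumeration. Since `k⁽ᴸ⁾(n) ≤ k(n)`, all the inequalities
become equalities. -/

/-! ### Fischer product, zonal harmonics and positivity of Gegenbauer kernels -/

section Fischer

open MvPolynomial

variable {ι : Type*} [Fintype ι]

/-- The Fischer inner product on polynomials, for which the monomials are orthogonal and `X ^ m`
has square norm `m!`. -/
noncomputable def fischer : MvPolynomial ι ℝ →ₗ[ℝ] MvPolynomial ι ℝ →ₗ[ℝ] ℝ :=
  (basisMonomials ι ℝ).constr ℝ fun m => ((∏ i, (m i).factorial : ℕ) : ℝ) • lcoeff ℝ m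

theorem fischer_monomial (m : ι →₀ ℕ) (q : MvPolynomial ι ℝ) :
    fischer (monomial m 1) q = ((∏ i, (m i).factorial : ℕ) : ℝ) * coeff m q := by
  have h := (basisMonomials ι ℝ).constr_basis ℝ
    (fun m => ((∏ i, (m i).factorial : ℕ) : ℝ) • lcoeff ℝ m) m
  rw [coe_basisMonomials] at h
  rw [fischer, h]
  simp

theorem fischer_self_nonneg (p : MvPolynomial ι ℝ) : 0 ≤ fischer p p := by
  have h : fischer p p = ∑ m ∈ p.support,
      coeff m p * (((∏ i, (m i).factorial : ℕ) : ℝ) * coeff m p) := by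
    conv_lhs => enter [1]; rw [p.as_sum]
    rw [map_sum, LinearMap.sum_apply]
    refine Finset.sum_congr rfl fun m _ => ?_
    rw [← fischer_monomial, ← smul_eq_mul, ← LinearMap.smul_apply, ← map_smul, smul_monomial,
      smul_eq_mul, mul_one]
  rw [h]
  refine Finset.sum_nonneg fun m _ => ?_
  rw [mul_left_comm]
  exact mul_nonneg (Nat.cast_nonneg _) (mul_self_nonneg _)

/-- On monomials, raising the `i`-th exponent multiplies `m!` by `m i + 1`, which is the factor that
differentiation produces in the coefficient. This adjunction drives everything below. -/
theorem fischer_X_mul (i : ι) (p q : MvPolynomial ι ℝ) :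
    fischer (X i * p) q = fischer p (pderiv i q) := by
  classical
  have h : (fischer.flip q) ∘ₗ LinearMap.mulLeft ℝ (X i) = fischer.flip (pderiv i q) := by
    refine (basisMonomials ι ℝ).ext fun m => ?_
    simp only [coe_basisMonomials, LinearMap.comp_apply, LinearMap.mulLeft_apply,
      LinearMap.flip_apply, fischer_monomial, coeff_pderiv]
    rw [X, monomial_mul, one_mul, fischer_monomial, add_comm (Finsupp.single i 1) m]
    have hf : ∏ k, ((m + Finsupp.single i 1 : ι →₀ ℕ) k).factorial = (m i + 1) * ∏ k, (m k).factorial := by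
      rw [← Finset.mul_prod_erase _ _ (Finset.mem_univ i),
        ← Finset.mul_prod_erase _ (fun k => (m k).factorial) (Finset.mem_univ i), ← mul_assoc]
      congr 1
      · simp [Nat.factorial_succ]
      · refine Finset.prod_congr rfl fun k hk => ?_
        rw [Finsupp.add_apply, Finsupp.single_eq_of_ne (Finset.ne_of_mem_erase hk), add_zero]
    rw [hf]
    push_cast
    ring
  exact LinearMap.congr_fun h p

/-- The linear form `X ↦ ⟨y, X⟩`. -/
noncomputable def linForm (y : ι → ℝ) : MvPolynomial ι ℝ := ∑ i, C (y i) * X i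

/-- The quadratic form `X ↦ ‖X‖²`. -/
noncomputable def sqForm (ι : Type*) [Fintype ι] : MvPolynomial ι ℝ := ∑ i, X i ^ 2

/-- The Laplace operator on polynomials. -/
noncomputable def laplacian : MvPolynomial ι ℝ →ₗ[ℝ] MvPolynomial ι ℝ :=
  ∑ i, (pderiv i).toLinearMap ∘ₗ (pderiv i).toLinearMap

theorem laplacian_apply (p : MvPolynomial ι ℝ) : laplacian p = ∑ i, pderiv i (pderiv i p) := by
  simp [laplacian]

theorem fischer_sqForm_mul (p q : MvPolynomial ι ℝ) :
    fischer (sqForm ι * p) q = fischer p (laplacian q) := by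
  rw [laplacian_apply, map_sum, sqForm, Finset.sum_mul, map_sum, LinearMap.sum_apply]
  refine Finset.sum_congr rfl fun i _ => ?_
  rw [sq, mul_assoc, fischer_X_mul, fischer_X_mul]

theorem fischer_linForm_pow (x : ι → ℝ) (k : ℕ) {q : MvPolynomial ι ℝ}
    (hq : q.IsHomogeneous k) : fischer (linForm x ^ k) q = k.factorial * eval x q := by
  induction k generalizing q with
  | zero =>
    rw [pow_zero, show (1 : MvPolynomial ι ℝ) = monomial 0 1 from rfl, fischer_monomial]
    obtain ⟨c, rfl⟩ : ∃ c, q = C c := 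
      ⟨_, totalDegree_eq_zero_iff_eq_C.mp (Nat.le_zero.mp (IsHomogeneous.totalDegree_le hq))⟩
    simp
  | succ k ih =>
    have h1 : fischer (linForm x ^ (k + 1)) q
        = ∑ i, x i * fischer (linForm x ^ k) (pderiv i q) := by
      rw [pow_succ', linForm, Finset.sum_mul, map_sum, LinearMap.sum_apply]
      refine Finset.sum_congr rfl fun i _ => ?_
      rw [mul_assoc, C_mul', map_smul, LinearMap.smul_apply, fischer_X_mul, smul_eq_mul]
    -- Euler's identity: `∑ x_i ∂_i q (x) = (k + 1) q(x)`, which turns `k!` into `(k + 1)!`.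
    have h2 := congrArg (eval x) hq.sum_X_mul_pderiv
    simp only [map_sum, map_mul, eval_X, nsmul_eq_mul, map_natCast] at h2
    have h3 (i : ι) := ih (q := pderiv i q) hq.pderiv
    simp only [h1, h3, mul_left_comm _ (k.factorial : ℝ), ← Finset.mul_sum, h2]
    rw [Nat.factorial_succ]
    push_cast
    ring

theorem pderiv_linForm (y : ι → ℝ) (i : ι) : pderiv i (linForm y) = C (y i) := by
  classical
  simp [linForm, pderiv_X, Pi.single_apply]

theorem pderiv_sqForm (i : ι) : pderiv i (sqForm ι) = 2 * X i := by
  classical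
  simp [sqForm, pderiv_X, Pi.single_apply]

/-- Leibniz rule, then summation over `i` with `∑ y_i² = 1`. The truncated exponents `a - 2` and `j
- 1` are harmless: the coefficient vanishes whenever truncation occurs. -/
theorem laplacian_linForm_pow_mul_sqForm_pow {y : ι → ℝ} (hy : ∑ i, y i ^ 2 = 1) (a j : ℕ) :
    laplacian (linForm y ^ a * sqForm ι ^ j) =
      ((a * (a - 1) : ℕ) : ℝ) • (linForm y ^ (a - 2) * sqForm ι ^ j) +
      ((2 * j * (2 * a + 2 * (j - 1) + Fintype.card ι) : ℕ) : ℝ) •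
        (linForm y ^ a * sqForm ι ^ (j - 1)) := by
  have key (i : ι) : pderiv i (pderiv i (linForm y ^ a * sqForm ι ^ j)) =
      ((a : MvPolynomial ι ℝ) * ((a - 1 : ℕ) : MvPolynomial ι ℝ) * linForm y ^ (a - 2) * sqForm ι ^ j) * C (y i ^ 2) +
      (4 * (a : MvPolynomial ι ℝ) * (j : MvPolynomial ι ℝ) * linForm y ^ (a - 1) * sqForm ι ^ (j - 1)) * (C (y i) * X i) +
      (4 * (j : MvPolynomial ι ℝ) * ((j - 1 : ℕ) : MvPolynomial ι ℝ) * linForm y ^ a * sqForm ι ^ (j - 2)) * X i ^ 2 +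
      2 * (j : MvPolynomial ι ℝ) * linForm y ^ a * sqForm ι ^ (j - 1) := by
    have h2 : pderiv i (2 : MvPolynomial ι ℝ) = 0 := pderiv_C (a := 2)
    have hn (n : ℕ) : pderiv i (n : MvPolynomial ι ℝ) = 0 := by
      rw [← map_natCast C]; exact pderiv_C
    simp only [pderiv_mul, pderiv_pow, pderiv_linForm, pderiv_sqForm, map_add, pderiv_C,
      pderiv_X_self, h2, hn, Nat.sub_sub, map_pow]
    ring
  have hl : (a : MvPolynomial ι ℝ) * (linForm y ^ (a - 1) * linForm y) = a * linForm y ^ a := by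
    cases a with
    | zero => simp
    | succ a => rw [Nat.add_sub_cancel, pow_succ]
  have hs : ((j - 1 : ℕ) : MvPolynomial ι ℝ) * (sqForm ι ^ (j - 2) * sqForm ι) =
      ((j - 1 : ℕ) : MvPolynomial ι ℝ) * sqForm ι ^ (j - 1) := by
    rcases j with _ | _ | j
    · simp
    · simp
    · rw [show j + 1 + 1 - 2 = j from rfl, show j + 1 + 1 - 1 = j + 1 from rfl, pow_succ]
  simp only [laplacian_apply, key, Finset.sum_add_distrib, ← Finset.mul_sum, ← map_sum, hy,
    Finset.sum_const, Finset.card_univ, nsmul_eq_mul, smul_eq_C_mul]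
  rw [← linForm, ← sqForm]
  push_cast
  simp only [map_mul, map_add, map_natCast, map_ofNat, map_one]
  linear_combination (4 * j * sqForm ι ^ (j - 1)) * hl + (4 * j * linForm y ^ a) * hs

/-- The coefficient of `t ^ (k - 2j)` in the monic Gegenbauer polynomial of degree `k` for the
sphere in `ℝⁿ`. -/
noncomputable def gegenbauerCoeff (n k : ℕ) : ℕ → ℝ
  | 0 => 1
  | j + 1 => -gegenbauerCoeff n k j * (k - 2 * j) * (k - 2 * j - 1) /
      (2 * (j + 1) * (2 * k - 2 * j - 4 + n))

/-- The monic Gegenbauer polynomial of degree `k` for the sphere in `ℝⁿ`. -/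
noncomputable def gegenbauer (n k : ℕ) (t : ℝ) : ℝ :=
  ∑ j ∈ Finset.range (k / 2 + 1), gegenbauerCoeff n k j * t ^ (k - 2 * j)

/-- The zonal harmonic polynomial of degree `k` with pole `y`. -/
noncomputable def zonal (k : ℕ) (y : ι → ℝ) : MvPolynomial ι ℝ :=
  ∑ j ∈ Finset.range (k / 2 + 1),
    gegenbauerCoeff (Fintype.card ι) k j • (linForm y ^ (k - 2 * j) * sqForm ι ^ j)

theorem isHomogeneous_zonal (k : ℕ) (y : ι → ℝ) : (zonal k y).IsHomogeneous k := by
  refine IsHomogeneous.sum _ _ _ fun j hj => ?_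
  have hl : (linForm y).IsHomogeneous 1 :=
    IsHomogeneous.sum _ _ _ fun i _ => (isHomogeneous_X ℝ i).C_mul _
  have hs : (sqForm ι).IsHomogeneous 2 := IsHomogeneous.sum _ _ _ fun i _ => by
    simpa using (isHomogeneous_X ℝ i).pow 2
  have h := (hl.pow (k - 2 * j)).mul (hs.pow j)
  rw [smul_eq_C_mul]
  have hk : 1 * (k - 2 * j) + 2 * j = k := by
    have := Finset.mem_range.mp hj
    omega
  rw [hk] at h
  exact h.C_mul _

theorem eval_zonal (k : ℕ) {x y : ι → ℝ} (hx : ∑ i, x i ^ 2 = 1) :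
    eval x (zonal k y) = gegenbauer (Fintype.card ι) k (∑ i, y i * x i) := by
  simp [zonal, gegenbauer, linForm, sqForm, smul_eval, hx]

/-- The recursion for `gegenbauerCoeff` is chosen so that the first part of the Laplacian of term
`j` cancels the second part of that of term `j + 1`. Nonemptiness of `ι` keeps its denominators
nonzero. -/
theorem laplacian_zonal [Nonempty ι] (k : ℕ) {y : ι → ℝ} (hy : ∑ i, y i ^ 2 = 1) :
    laplacian (zonal k y) = 0 := by
  simp only [zonal, map_sum, map_smul, laplacian_linForm_pow_mul_sqForm_pow hy, smul_add,
    Finset.sum_add_distrib]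
  rw [Finset.sum_range_succ, Finset.sum_range_succ']
  -- The last term has `linForm y` to the power 0 or 1, so its first part has no partner to cancel
  -- and must vanish by itself.
  have h0 : (k - 2 * (k / 2)) * (k - 2 * (k / 2) - 1) = 0 := by
    rcases Nat.mod_two_eq_zero_or_one k with h | h
    · rw [show k - 2 * (k / 2) = 0 by omega, Nat.zero_mul]
    · rw [show k - 2 * (k / 2) - 1 = 0 by omega, Nat.mul_zero]
  simp only [h0, Nat.cast_zero, zero_smul, smul_zero, add_zero, Nat.mul_zero, Nat.zero_mul]
  rw [← Finset.sum_add_distrib]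
  refine Finset.sum_eq_zero fun j hj => ?_
  obtain ⟨m, rfl⟩ : ∃ m, k = 2 * j + 2 + m := ⟨k - (2 * j + 2), by
    have := Finset.mem_range.mp hj
    omega⟩
  have hn : (0 : ℝ) < Fintype.card ι := Nat.cast_pos.mpr Fintype.card_pos
  rw [show 2 * j + 2 + m - 2 * j = m + 2 by omega, show 2 * j + 2 + m - 2 * (j + 1) = m by omega,
    Nat.add_sub_cancel, Nat.add_sub_cancel, smul_smul, smul_smul, ← add_smul]
  convert zero_smul ℝ _
  rw [gegenbauerCoeff, show m + 2 - 1 = m + 1 from rfl]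
  have hd : (2 * j + 2 * m + Fintype.card ι : ℝ) ≠ 0 := by positivity
  have hd' : (2 : ℝ) * (2 * j + 2 + m : ℕ) - 2 * j - 4 + Fintype.card ι =
      2 * j + 2 * m + Fintype.card ι := by
    push_cast
    ring
  rw [hd']
  push_cast
  field_simp
  ring

/-- Every term of `zonal k x` except the leading `linForm x ^ k` is divisible by `sqForm`, hence
orthogonal to the harmonic polynomial `zonal k y`; the leading term evaluates it at `x`. -/
theorem fischer_zonal [Nonempty ι] (k : ℕ) {x y : ι → ℝ} (hx : ∑ i, x i ^ 2 = 1)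
    (hy : ∑ i, y i ^ 2 = 1) :
    fischer (zonal k x) (zonal k y) =
      k.factorial * gegenbauer (Fintype.card ι) k (∑ i, y i * x i) := by
  rw [← eval_zonal k hx, ← fischer_linForm_pow x k (isHomogeneous_zonal k y)]
  nth_rewrite 1 [zonal]
  rw [Finset.sum_range_succ', map_add, map_sum, LinearMap.add_apply, LinearMap.sum_apply,
    Finset.sum_eq_zero, zero_add]
  · simp [gegenbauerCoeff]
  · intro j _
    rw [pow_succ', mul_left_comm, map_smul, LinearMap.smul_apply, fischer_sqForm_mul,
      laplacian_zonal k hy, map_zero, smul_zero]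

/-- Gegenbauer polynomials are positive definite functions on the sphere. -/
theorem sum_gegenbauer_nonneg [Nonempty ι] (k : ℕ) (X : Finset (ι → ℝ))
    (hX : ∀ x ∈ X, ∑ i, x i ^ 2 = 1) :
    0 ≤ ∑ x ∈ X, ∑ y ∈ X, gegenbauer (Fintype.card ι) k (∑ i, y i * x i) := by
  have h := fischer_self_nonneg (∑ x ∈ X, zonal k x)
  have h' : fischer (∑ x ∈ X, zonal k x) (∑ x ∈ X, zonal k x) = k.factorial *
      ∑ x ∈ X, ∑ y ∈ X, gegenbauer (Fintype.card ι) k (∑ i, y i * x i) := by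
    simp only [map_sum, LinearMap.sum_apply]
    rw [Finset.sum_comm, Finset.mul_sum]
    refine Finset.sum_congr rfl fun x hx => ?_
    rw [Finset.mul_sum]
    exact Finset.sum_congr rfl fun y hy => fischer_zonal k (hX x hx) (hX y hy)
  rw [h'] at h
  exact nonneg_of_mul_nonneg_right h (Nat.cast_pos.mpr k.factorial_pos)

end Fischer

/-! ### The linear programming bound -/

/-- The linear programming bound for spherical codes of minimal angle `π / 3`. -/
theorem card_le_of_gegenbauer {n : ℕ} [NeZero n] {d : ℕ} {a : ℕ → ℝ} (ha : ∀ k, 0 ≤ a k)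
    (ha0 : 0 < a 0) {f : ℝ → ℝ}
    (hf : ∀ t, f t = ∑ k ∈ Finset.range (d + 1), a k * gegenbauer n k t)
    (hneg : ∀ t, -1 ≤ t → t ≤ 1 / 2 → f t ≤ 0) {N : ℕ} (hN : f 1 ≤ N * a 0)
    {X : Finset (Fin n → ℝ)} (hX : ∀ x ∈ X, ∑ i, x i ^ 2 = 1)
    (hXX : ∀ x ∈ X, ∀ y ∈ X, x ≠ y → ∑ i, y i * x i ≤ 1 / 2) : X.card ≤ N := by
  classical
  have hlow : a 0 * (X.card : ℝ) ^ 2 ≤ ∑ x ∈ X, ∑ y ∈ X, f (∑ i, y i * x i) := by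
    -- `G_0 = 1`, so the degree 0 part contributes `a 0 * |X|²` and the other degrees contribute
    -- nonnegatively.
    have h (x y : Fin n → ℝ) : f (∑ i, y i * x i) = a 0 + ∑ k ∈ Finset.range d,
        a (k + 1) * gegenbauer n (k + 1) (∑ i, y i * x i) := by
      rw [hf, Finset.sum_range_succ', add_comm]
      simp [gegenbauer, gegenbauerCoeff]
    simp only [h, Finset.sum_add_distrib, Finset.sum_const, nsmul_eq_mul]
    have h2 : 0 ≤ ∑ x ∈ X, ∑ y ∈ X, ∑ k ∈ Finset.range d,
        a (k + 1) * gegenbauer n (k + 1) (∑ i, y i * x i) := by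
      simp only [Finset.sum_comm (s := X) (t := Finset.range d)]
      refine Finset.sum_nonneg fun k _ => ?_
      simp only [← Finset.mul_sum]
      refine mul_nonneg (ha _) ?_
      simpa using sum_gegenbauer_nonneg (k + 1) X hX
    nlinarith
  have hup : ∑ x ∈ X, ∑ y ∈ X, f (∑ i, y i * x i) ≤ X.card * f 1 := by
    rw [← nsmul_eq_mul]
    refine Finset.sum_le_card_nsmul _ _ _ fun x hx => ?_
    rw [← Finset.add_sum_erase X _ hx]
    have h1 : f (∑ i, x i * x i) = f 1 := by
      simp only [← sq, hX x hx]
    have h2 : ∑ y ∈ X.erase x, f (∑ i, y i * x i) ≤ 0 := by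
      refine Finset.sum_nonpos fun y hy => ?_
      obtain ⟨hyx, hy⟩ := Finset.mem_erase.mp hy
      refine hneg _ ?_ (hXX x hx y hy hyx.symm)
      -- Nonnegativity of `‖x + y‖²` gives the lower bound `-1` on the inner product of unit
      -- vectors.
      have h3 : 0 ≤ ∑ i, (y i + x i) ^ 2 := Finset.sum_nonneg fun _ _ => sq_nonneg _
      simp only [add_sq, Finset.sum_add_distrib, hX x hx, hX y hy, mul_assoc,
        ← Finset.mul_sum] at h3
      linarith
    linarith
  rcases X.eq_empty_or_nonempty with rfl | hne
  · simp
  have hc : (0 : ℝ) < X.card := Nat.cast_pos.mpr hne.card_pos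
  have h : a 0 * X.card * X.card ≤ a 0 * N * X.card := by nlinarith
  exact_mod_cast le_of_mul_le_mul_left (le_of_mul_le_mul_right h hc) ha0

theorem kissingNumber_le_of_gegenbauer {n : ℕ} [NeZero n] {d : ℕ} {a : ℕ → ℝ}
    (ha : ∀ k, 0 ≤ a k) (ha0 : 0 < a 0) {f : ℝ → ℝ}
    (hf : ∀ t, f t = ∑ k ∈ Finset.range (d + 1), a k * gegenbauer n k t)
    (hneg : ∀ t, -1 ≤ t → t ≤ 1 / 2 → f t ≤ 0) {N : ℕ} (hN : f 1 ≤ N * a 0) :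
    kissingNumber n ≤ N := by
  refine iSup₂_le fun X hX => ?_
  by_contra! hlt
  -- The configuration is not known to be finite, so the bound is applied to a subset of exactly `N
  -- + 1` points, halved to lie on the unit sphere.
  obtain ⟨Y, hYX, hY⟩ := Set.exists_subset_encard_eq (Order.add_one_le_of_lt hlt)
  have hfin : Y.Finite := Set.finite_of_encard_eq_coe (k := N + 1) (by rw [hY]; rfl)
  have hinj : Function.Injective fun (x : Euc n) (i : Fin n) => x i / 2 := by
    intro x y hxy
    ext i
    have := congrFun hxy i
    simpa using this
  have hnorm (x : Euc n) (hx : x ∈ Y) : ∑ i, x i ^ 2 = 4 := by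
    have h := (hX.1 x (hYX hx))
    rw [dist_zero_right] at h
    rw [← EuclideanSpace.real_norm_sq_eq, h]
    norm_num
  have hcard := card_le_of_gegenbauer (X := hfin.toFinset.map ⟨_, hinj⟩) ha ha0 hf hneg hN ?_ ?_
  · rw [Finset.card_map] at hcard
    rw [hfin.encard_eq_coe_toFinset_card] at hY
    have : hfin.toFinset.card = N + 1 := by exact_mod_cast hY
    omega
  · intro x hx
    obtain ⟨x, hx', rfl⟩ := Finset.mem_map.mp hx
    have := hnorm x (hfin.mem_toFinset.mp hx')
    simp only [Function.Embedding.coeFn_mk, div_pow, ← Finset.sum_div, this]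
    norm_num
  · intro x hx y hy hxy
    obtain ⟨x, hx', rfl⟩ := Finset.mem_map.mp hx
    obtain ⟨y, hy', rfl⟩ := Finset.mem_map.mp hy
    rw [hfin.mem_toFinset] at hx' hy'
    have hd := hX.2 x (hYX hx') y (hYX hy') (fun h => hxy (by rw [h]))
    have h4 : 2 ^ 2 ≤ ∑ i, (x i - y i) ^ 2 := by
      rw [dist_eq_norm] at hd
      have := pow_le_pow_left₀ (by norm_num) hd 2
      rwa [EuclideanSpace.real_norm_sq_eq] at this
    simp only [sub_sq, Finset.sum_add_distrib, Finset.sum_sub_distrib, hnorm x hx', hnorm y hy',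
      mul_assoc, ← Finset.mul_sum] at h4
    have h5 : ∑ i, y i / 2 * (x i / 2) = (∑ i, x i * y i) / 4 := by
      rw [Finset.sum_div]
      exact Finset.sum_congr rfl fun i _ => by ring
    simp only [Function.Embedding.coeFn_mk, h5]
    linarith

/-! ### Optimal polynomials in dimensions 8 and 24 -/

/-- Equality in the bound forces `f` to vanish at all inner products of distinct normalised minimal
vectors of `E₈`, namely `-1, ±1/2, 0`. The roots interior to `[-1, 1/2]` are doubled to keep the
sign. The listed `a k` are the coordinates of `f` in the monic Gegenbauer basis, and `f(1) = 9/4 =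
240 · 3/320`. -/
theorem kissingNumber_eight_le : kissingNumber 8 ≤ 240 := by
  refine kissingNumber_le_of_gegenbauer (d := 6) (N := 240)
    (f := fun t => (t + 1) * (t + 1 / 2) ^ 2 * t ^ 2 * (t - 1 / 2))
    (a := fun k => [3/320, 3/40, 15/56, 39/56, 19/16, 3/2, 1].getD k 0) ?_ ?_ ?_ ?_ ?_
  · intro k
    rcases k with _ | _ | _ | _ | _ | _ | _ | k <;> norm_num
  · norm_num
  · intro t
    simp only [Finset.sum_range_succ, Finset.sum_range_zero, gegenbauer, gegenbauerCoeff,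
      List.getD_cons_zero, List.getD_cons_succ, Nat.reduceDiv, Nat.reduceMul, Nat.reduceSub,
      Nat.reduceAdd]
    norm_num
    ring
  · intro t h1 h2
    exact mul_nonpos_of_nonneg_of_nonpos
      (mul_nonneg (mul_nonneg (by linarith) (sq_nonneg _)) (sq_nonneg _)) (by linarith)
  · norm_num

/-- The same recipe with the inner products `-1, ±1/2, ±1/4, 0` of the Leech lattice; `f(1) =
2025/1024 = 196560 · 15/1490944`. -/
theorem kissingNumber_twentyFour_le : kissingNumber 24 ≤ 196560 := by
  refine kissingNumber_le_of_gegenbauer (d := 10) (N := 196560)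
    (f := fun t => (t + 1) * (t + 1 / 2) ^ 2 * (t + 1 / 4) ^ 2 * t ^ 2 * (t - 1 / 4) ^ 2 *
      (t - 1 / 2))
    (a := fun k => [15/1490944, 45/186368, 495/243712, 435/34816, 6927/139264, 1467/8704,
      17747/43776, 261/304, 5/4, 3/2, 1].getD k 0) ?_ ?_ ?_ ?_ ?_
  · intro k
    rcases k with _ | _ | _ | _ | _ | _ | _ | _ | _ | _ | _ | k <;> norm_num
  · norm_num
  · intro t
    simp only [Finset.sum_range_succ, Finset.sum_range_zero, gegenbauer, gegenbauerCoeff,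
      List.getD_cons_zero, List.getD_cons_succ, Nat.reduceDiv, Nat.reduceMul, Nat.reduceSub,
      Nat.reduceAdd]
    norm_num
    ring
  · intro t h1 h2
    exact mul_nonpos_of_nonneg_of_nonpos
      (mul_nonneg (mul_nonneg (mul_nonneg (mul_nonneg (by linarith) (sq_nonneg _)) (sq_nonneg _))
        (sq_nonneg _)) (sq_nonneg _)) (by linarith)
  · norm_num

/-! ### Minimal vectors, scaling and kissing configurations -/

section Lattice

variable {n : ℕ} {L : Submodule ℤ (Euc n)} {r : ℝ}

theorem HasLeastLength.minimalVectors_eq (h : HasLeastLength L r) :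
    minimalVectors L = {x | x ∈ L ∧ ‖x‖ = r} := by
  ext x
  refine and_congr_right fun _ => ⟨fun hx => hx.unique h, fun hx => ?_⟩
  rw [hx]
  exact h

theorem hasLeastLength_of_sq (hr : 0 ≤ r) (hle : ∀ x ∈ L, x ≠ 0 → r ^ 2 ≤ ∑ i, x i ^ 2)
    {x : Euc n} (hx : x ∈ L) (hx0 : x ≠ 0) (hxr : ∑ i, x i ^ 2 = r ^ 2) : HasLeastLength L r := by
  constructor
  · refine ⟨x, hx, hx0, ?_⟩
    rwa [← EuclideanSpace.real_norm_sq_eq, sq_eq_sq₀ (norm_nonneg _) hr] at hxr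
  · rintro _ ⟨y, hy, hy0, rfl⟩
    have := hle y hy hy0
    rwa [← EuclideanSpace.real_norm_sq_eq, sq_le_sq₀ hr (norm_nonneg _)] at this

/-- A positive least length isolates the origin, hence gives discreteness; nonzero multiples of the
coordinate vectors give full rank. -/
theorem HasLeastLength.isLatticeIn (h : HasLeastLength L r) (hr : 0 < r)
    (hspan : ∀ i, ∃ c : ℝ, c ≠ 0 ∧ EuclideanSpace.single i c ∈ L) : IsLatticeIn L := by
  have hd : DiscreteTopology L := by
    refine discreteTopology_of_isOpen_singleton_zero (Metric.isOpen_singleton_iff.mpr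
      ⟨r, hr, fun y hy => ?_⟩)
    by_contra hy0
    have h1 := h.2 ⟨(y : Euc n), y.2, fun h => hy0 (Subtype.ext h), rfl⟩
    rw [dist_zero_right] at hy
    exact absurd h1 (not_le.mpr hy)
  refine ⟨hd, ⟨?_⟩⟩
  rw [eq_top_iff, ← (EuclideanSpace.basisFun (Fin n) ℝ).toBasis.span_eq, Submodule.span_le]
  rintro _ ⟨i, rfl⟩
  obtain ⟨c, hc, hcL⟩ := hspan i
  have h1 := Submodule.smul_mem _ c⁻¹ (Submodule.subset_span (R := ℝ) hcL)
  have h2 : c⁻¹ • EuclideanSpace.single i c = EuclideanSpace.basisFun (Fin n) ℝ i := by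
    ext j
    by_cases hj : j = i <;> simp [hj, hc]
  rw [h2] at h1
  simpa using h1

theorem HasLeastLength.isKissingConfiguration (h : HasLeastLength L 2) :
    IsKissingConfiguration (minimalVectors L) := by
  rw [h.minimalVectors_eq]
  refine ⟨fun x hx => by rw [dist_zero_right, hx.2], fun x hx y hy hxy => ?_⟩
  rw [dist_eq_norm]
  exact h.2 ⟨x - y, L.sub_mem hx.1 hy.1, sub_ne_zero.mpr hxy, rfl⟩

theorem latticeKissingNumber_le (n : ℕ) : latticeKissingNumber n ≤ kissingNumber n :=
  iSup₂_le fun X hX => le_iSup₂_of_le X hX.1 le_rfl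

theorem KissesWith.le_latticeKissingNumber {N : ℕ∞} (h : KissesWith L N) :
    N ≤ latticeKissingNumber n := by
  obtain ⟨h1, h2, h3, rfl⟩ := h
  exact le_iSup₂_of_le (minimalVectors L) ⟨h3, L, h1, h2, fun x hx => hx.1⟩ le_rfl

theorem KissesWith.kissingNumber_eq {N : ℕ∞} (h : KissesWith L N) (hN : kissingNumber n ≤ N) :
    kissingNumber n = N :=
  le_antisymm hN (h.le_latticeKissingNumber.trans (latticeKissingNumber_le n))

theorem KissesWith.latticeKissingNumber_eq {N : ℕ∞} (h : KissesWith L N)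
    (hN : kissingNumber n ≤ N) : latticeKissingNumber n = N :=
  le_antisymm ((latticeKissingNumber_le n).trans hN) h.le_latticeKissingNumber

theorem HasLeastLength.smul (h : HasLeastLength L r) {c : ℝ} (hc : 0 < c) :
    HasLeastLength (c • L) (c * r) := by
  constructor
  · obtain ⟨x, hx, hx0, rfl⟩ := h.1
    exact ⟨c • x, Submodule.smul_mem_pointwise_smul x c L hx, smul_ne_zero hc.ne' hx0, by
      rw [norm_smul, Real.norm_of_nonneg hc.le]⟩
  · rintro _ ⟨_, ⟨x, hx, rfl⟩, hx0, rfl⟩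
    have hx0' : x ≠ 0 := by
      rintro rfl
      exact hx0 (map_zero _)
    have := h.2 ⟨x, hx, hx0', rfl⟩
    change c * r ≤ ‖c • x‖
    rw [norm_smul, Real.norm_of_nonneg hc.le]
    gcongr

theorem HasLeastLength.encard_minimalVectors_smul (h : HasLeastLength L r) {c : ℝ} (hc : 0 < c) :
    (minimalVectors (c • L)).encard = (minimalVectors L).encard := by
  rw [(h.smul hc).minimalVectors_eq, h.minimalVectors_eq]
  refine Eq.trans (congrArg Set.encard ?_) ((smul_right_injective (Euc n) hc.ne').encard_image _)
  ext y
  constructor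
  · rintro ⟨⟨x, hx, rfl⟩, hy⟩
    refine ⟨x, ⟨hx, ?_⟩, rfl⟩
    change ‖c • x‖ = _ at hy
    rw [norm_smul, Real.norm_of_nonneg hc.le] at hy
    exact mul_left_cancel₀ hc.ne' hy
  · rintro ⟨x, ⟨hx, rfl⟩, rfl⟩
    refine ⟨Submodule.smul_mem_pointwise_smul x c L hx, ?_⟩
    change ‖c • x‖ = _
    rw [norm_smul, Real.norm_of_nonneg hc.le]

end Lattice

/-! ### Counting integral vectors with entries `-1, 0, 1` -/

section Signed

variable {ι : Type*}

/-- The vector with entries `-1` on `t`, `1` on `s \ t` and `0` elsewhere, for `p = ⟨s, t⟩`. -/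
def signedIndicator [DecidableEq ι] (p : (_ : Finset ι) × Finset ι) (i : ι) : ℤ :=
  if i ∈ p.2 then -1 else if i ∈ p.1 then 1 else 0

theorem encard_image_signedIndicator [DecidableEq ι] {S : Finset (Finset ι)} {T : Finset ι → Finset (Finset ι)}
    (hT : ∀ s ∈ S, ∀ t ∈ T s, t ⊆ s) :
    (signedIndicator '' (S.sigma T : Set ((_ : Finset ι) × Finset ι))).encard =
      (∑ s ∈ S, (T s).card : ℕ) := by
  rw [Set.InjOn.encard_image, Set.encard_coe_eq_coe_finsetCard, Finset.card_sigma]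
  rintro ⟨s, t⟩ hp ⟨s', t'⟩ hp' h
  obtain ⟨hs, ht⟩ := Finset.mem_sigma.mp hp
  obtain ⟨hs', ht'⟩ := Finset.mem_sigma.mp hp'
  have hsub := hT s hs t ht
  have hsub' := hT s' hs' t' ht'
  have h1 : s = s' := by
    ext i
    have := congrFun h i
    have h2 := @hsub i
    have h3 := @hsub' i
    simp only [signedIndicator] at this
    grind
  have h2 : t = t' := by
    ext i
    have := congrFun h i
    simp only [signedIndicator] at this
    grind
  rw [h1, h2]

theorem sum_signedIndicator [Fintype ι] [DecidableEq ι] {s t : Finset ι} (h : t ⊆ s) :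
    ∑ i, signedIndicator ⟨s, t⟩ i = s.card - 2 * t.card := by
  have h1 (i : ι) : signedIndicator ⟨s, t⟩ i =
      (if i ∈ s then 1 else 0) - 2 * (if i ∈ t then 1 else 0) := by
    have := @h i
    simp only [signedIndicator]
    grind
  simp [h1, Finset.sum_sub_distrib, mul_comm]

theorem sum_signedIndicator_sq [Fintype ι] [DecidableEq ι] {s t : Finset ι} (h : t ⊆ s) :
    ∑ i, signedIndicator ⟨s, t⟩ i ^ 2 = s.card := by
  have h1 (i : ι) : signedIndicator ⟨s, t⟩ i ^ 2 = if i ∈ s then 1 else 0 := by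
    have := @h i
    simp only [signedIndicator]
    grind
  simp [h1]

theorem odd_signedIndicator [DecidableEq ι] {s t : Finset ι} (h : t ⊆ s) (i : ι) :
    Odd (signedIndicator ⟨s, t⟩ i) ↔ i ∈ s := by
  have := @h i
  by_cases ht : i ∈ t
  · simp [signedIndicator, ht, this ht]
  · by_cases hs : i ∈ s <;> simp [signedIndicator, ht, hs]

theorem eq_signedIndicator [Fintype ι] [DecidableEq ι] {v : ι → ℤ} (hv : ∀ i, v i ^ 2 ≤ 1) :
    v = signedIndicator ⟨Finset.univ.filter (fun i => Odd (v i)),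
      Finset.univ.filter (fun i => v i = -1)⟩ := by
  ext i
  have h := hv i
  have h1 : -1 ≤ v i := by nlinarith
  have h2 : v i ≤ 1 := by nlinarith
  simp only [signedIndicator, Finset.mem_filter, Finset.mem_univ, true_and]
  obtain h | h | h : v i = -1 ∨ v i = 0 ∨ v i = 1 := by omega
  all_goals simp [h]

theorem filter_eq_neg_one_subset [Fintype ι] (v : ι → ℤ) :
    Finset.univ.filter (fun i => v i = -1) ⊆ Finset.univ.filter (fun i => Odd (v i)) := by
  intro i hi
  have := (Finset.mem_filter.mp hi).2
  simp [this]

/-- The roots of type `D`: integral vectors of square norm `2`. -/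
theorem encard_sum_sq_eq_two [Fintype ι] :
    {v : ι → ℤ | ∑ i, v i ^ 2 = 2}.encard = ((Fintype.card ι).choose 2 * 4 : ℕ) := by
  classical
  have h : {v : ι → ℤ | ∑ i, v i ^ 2 = 2} = signedIndicator ''
      (((Finset.powersetCard 2 Finset.univ).sigma Finset.powerset :
        Finset ((_ : Finset ι) × Finset ι)) : Set ((_ : Finset ι) × Finset ι)) := by
    ext v
    constructor
    · intro hv
      have hv' : ∑ i, v i ^ 2 = 2 := hv
      have h1 (i : ι) : v i ^ 2 ≤ 1 := by
        have : v i ^ 2 ≤ 2 :=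
          hv' ▸ Finset.single_le_sum (fun j _ => sq_nonneg (v j)) (Finset.mem_univ i)
        have h1 : -1 ≤ v i := by nlinarith
        have h2 : v i ≤ 1 := by nlinarith
        nlinarith
      have h2 := eq_signedIndicator h1
      have h3 := filter_eq_neg_one_subset v
      refine ⟨_, ?_, h2.symm⟩
      rw [h2, sum_signedIndicator_sq h3] at hv'
      simp only [Finset.coe_sigma, Set.mem_sigma_iff, Finset.mem_coe, Finset.mem_powersetCard,
        Finset.mem_powerset]
      exact ⟨⟨Finset.subset_univ _, by exact_mod_cast hv'⟩, h3⟩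
    · rintro ⟨⟨s, t⟩, hp, rfl⟩
      simp only [Finset.coe_sigma, Set.mem_sigma_iff, Finset.mem_coe, Finset.mem_powersetCard,
        Finset.mem_powerset] at hp
      change ∑ i, _ = _
      rw [sum_signedIndicator_sq hp.2, hp.1.2]
      rfl
  rw [h, encard_image_signedIndicator fun s _ t ht => Finset.mem_powerset.mp ht,
    Finset.sum_congr rfl fun s hs => by
      rw [Finset.card_powerset, (Finset.mem_powersetCard.mp hs).2],
    Finset.sum_const, Finset.card_powersetCard, Finset.card_univ, smul_eq_mul]
  rfl

/-- The alternating sum over subsets of a nonempty set vanishes, so exactly half of them have even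
size. -/
theorem card_even_powerset {s : Finset ι} (hs : s.Nonempty) :
    (s.powerset.filter fun t => Even t.card).card = 2 ^ (s.card - 1) := by
  have h1 := Finset.sum_powerset_neg_one_pow_card_of_nonempty hs
  have h2 := Finset.card_filter_add_card_filter_not (s := s.powerset) (fun t => Even t.card)
  rw [← Finset.sum_filter_add_sum_filter_not _ (fun t => Even t.card),
    Finset.sum_congr rfl fun t ht => (Finset.mem_filter.mp ht).2.neg_one_pow,
    Finset.sum_congr (s₁ := s.powerset.filter fun t => ¬ Even t.card) rfl fun t ht =>
      (Nat.not_even_iff_odd.mp (Finset.mem_filter.mp ht).2).neg_one_pow] at h1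
  simp only [Finset.sum_const, nsmul_eq_mul, mul_one, mul_neg] at h1
  rw [Finset.card_powerset] at h2
  have h3 : s.card = s.card - 1 + 1 := (Nat.succ_pred_eq_of_pos hs.card_pos).symm
  rw [h3, pow_succ] at h2
  omega

/-- Odd entries have square at least 1 and there are `k` of them, so square norm `k` forces them to
be `±1` and the others to be 0. With `t` the set of `-1`s the sum is `k - 2 |t|`, so, as `4 ∣ k`,
the last condition says that `|t|` is even. It serves both the half-integral vectors of `E₈` and the
octad vectors of the Leech lattice. -/
theorem encard_odd_support_mem [Fintype ι] [DecidableEq ι] {S : Finset (Finset ι)} {k : ℕ} (hk : 4 ∣ k) (hk0 : 0 < k)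
    (hS : ∀ s ∈ S, s.card = k) :
    {v : ι → ℤ | Finset.univ.filter (fun i => Odd (v i)) ∈ S ∧ ∑ i, v i ^ 2 = k ∧
      4 ∣ ∑ i, v i}.encard = (S.card * 2 ^ (k - 1) : ℕ) := by
  have h : {v : ι → ℤ | Finset.univ.filter (fun i => Odd (v i)) ∈ S ∧ ∑ i, v i ^ 2 = k ∧
      4 ∣ ∑ i, v i} = signedIndicator '' (S.sigma fun s => s.powerset.filter fun t => Even t.card :
        Set ((_ : Finset ι) × Finset ι)) := by
    ext v
    constructor
    · rintro ⟨hvS, hv, hv4⟩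
      have h1 (i : ι) : v i ^ 2 ≤ 1 := by
        have hle (i : ι) : (if Odd (v i) then 1 else 0) ≤ v i ^ 2 := by
          split_ifs with ho
          · have : v i ≠ 0 := by
              rintro h
              simp [h] at ho
            have := sq_pos_of_ne_zero this
            omega
          · positivity
        have hsum : ∑ i, (if Odd (v i) then 1 else 0) = ∑ i, v i ^ 2 := by
          rw [hv, ← hS _ hvS, Finset.sum_boole]
        have := (Finset.sum_eq_sum_iff_of_le fun i _ => hle i).mp hsum i (Finset.mem_univ i)
        rw [← this]
        split_ifs <;> norm_num
      have h2 := eq_signedIndicator h1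
      have h3 := filter_eq_neg_one_subset v
      refine ⟨_, ?_, h2.symm⟩
      rw [h2, sum_signedIndicator h3, hS _ hvS] at hv4
      simp only [Finset.coe_sigma, Set.mem_sigma_iff, Finset.mem_coe, Finset.mem_filter,
        Finset.mem_powerset]
      refine ⟨hvS, h3, ?_⟩
      rw [Nat.even_iff]
      omega
    · rintro ⟨⟨s, t⟩, hp, rfl⟩
      simp only [Finset.coe_sigma, Set.mem_sigma_iff, Finset.mem_coe, Finset.mem_filter,
        Finset.mem_powerset] at hp
      obtain ⟨hs, hts, ht⟩ := hp
      refine ⟨?_, ?_, ?_⟩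
      · simp only [odd_signedIndicator hts, Finset.filter_univ_mem]
        exact hs
      · rw [sum_signedIndicator_sq hts, hS s hs]
      · rw [sum_signedIndicator hts, hS s hs]
        rw [Nat.even_iff] at ht
        omega
  rw [h, encard_image_signedIndicator fun s _ t ht =>
      Finset.mem_powerset.mp (Finset.mem_filter.mp ht).1,
    Finset.sum_congr rfl fun s hs => by
      rw [card_even_powerset (Finset.card_pos.mp (by rw [hS s hs]; exact hk0)), hS s hs],
    Finset.sum_const, smul_eq_mul]

end Signed

/-! ### Scaled integral vectors and parity of norms -/

section IntVec

variable {n : ℕ}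

/-- The real multiple `c • v` of an integral vector `v`. -/
noncomputable def intVec (c : ℝ) (v : Fin n → ℤ) : Euc n := WithLp.toLp 2 fun i => c * v i

@[simp]
theorem intVec_apply (c : ℝ) (v : Fin n → ℤ) (i : Fin n) : intVec c v i = c * v i := rfl

theorem intVec_injective {c : ℝ} (hc : c ≠ 0) :
    Function.Injective (intVec c : (Fin n → ℤ) → Euc n) := by
  intro v w h
  ext i
  have := congrArg (fun x : Euc n => x i) h
  simpa [hc] using this

theorem sum_intVec_sq (c : ℝ) (v : Fin n → ℤ) :
    ∑ i, intVec c v i ^ 2 = c ^ 2 * (∑ i, v i ^ 2 : ℤ) := by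
  simp [mul_pow, Finset.mul_sum]

theorem norm_eq_iff_sum_sq {x : Euc n} {r : ℝ} (hr : 0 ≤ r) :
    ‖x‖ = r ↔ ∑ i, x i ^ 2 = r ^ 2 := by
  rw [← EuclideanSpace.real_norm_sq_eq, sq_eq_sq₀ (norm_nonneg _) hr]

theorem intVec_zero (c : ℝ) : intVec c (0 : Fin n → ℤ) = 0 := by
  ext i
  simp

theorem even_sum_sq_iff {ι : Type*} (s : Finset ι) (v : ι → ℤ) :
    Even (∑ i ∈ s, v i ^ 2) ↔ Even (∑ i ∈ s, v i) := by
  have h : Even (∑ i ∈ s, v i ^ 2 - ∑ i ∈ s, v i) := by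
    rw [← Finset.sum_sub_distrib]
    refine Finset.even_sum _ fun i _ => ?_
    rw [sq, ← mul_sub_one]
    exact Int.even_mul_pred_self _
  exact Int.even_sub.mp h

theorem two_le_sum_sq {ι : Type*} [Fintype ι] {v : ι → ℤ} (hv : v ≠ 0)
    (he : Even (∑ i, v i)) : 2 ≤ ∑ i, v i ^ 2 := by
  obtain ⟨i, hi⟩ := Function.ne_iff.mp hv
  have h1 : 0 < ∑ i, v i ^ 2 := Finset.sum_pos' (fun i _ => sq_nonneg _)
    ⟨i, Finset.mem_univ i, sq_pos_of_ne_zero hi⟩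
  obtain ⟨k, hk⟩ := (even_sum_sq_iff _ v).mpr he
  omega

theorem card_filter_odd_le_sum_sq {ι : Type*} [Fintype ι] (v : ι → ℤ) :
    ((Finset.univ.filter fun i => Odd (v i)).card : ℤ) ≤ ∑ i, v i ^ 2 := by
  rw [← Finset.sum_boole]
  refine Finset.sum_le_sum fun i _ => ?_
  split_ifs with ho
  · have : v i ≠ 0 := by
      rintro h
      simp [h] at ho
    have := sq_pos_of_ne_zero this
    omega
  · positivity

end IntVec

/-! ### The lattice `E₈` -/

theorem mem_latticeE8_iff {x : Euc 8} : x ∈ latticeE8 ↔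
    (∃ v, Even (∑ i, v i) ∧ intVec 1 v = x) ∨
    (∃ v, (∀ i, Odd (v i)) ∧ 4 ∣ ∑ i, v i ∧ intVec (1 / 2) v = x) := by
  constructor
  · rintro ⟨h | h, s, hs⟩
    · choose a ha using h
      refine Or.inl ⟨a, ⟨s, ?_⟩, ?_⟩
      · simp only [ha] at hs
        rw [← two_mul]
        exact_mod_cast hs
      · ext i
        simp [ha]
    · choose a ha using h
      refine Or.inr ⟨fun i => 2 * a i + 1, fun i => ⟨a i, rfl⟩, ⟨s, ?_⟩, ?_⟩
      · have h1 : ((∑ i, (2 * a i + 1) : ℤ) : ℝ) = ((4 * s : ℤ) : ℝ) := by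
          have : ∑ i, (2 * (a i : ℝ) + 1) = 2 * ∑ i, x i := by
            rw [Finset.mul_sum]
            exact Finset.sum_congr rfl fun i _ => by rw [ha]; ring
          push_cast
          rw [this, hs]
          ring
        exact_mod_cast h1
      · ext i
        rw [intVec_apply, ha]
        push_cast
        ring
  · rintro (⟨v, ⟨s, hs⟩, rfl⟩ | ⟨v, ho, ⟨s, hs⟩, rfl⟩)
    · refine ⟨Or.inl fun i => ⟨v i, by simp⟩, s, ?_⟩
      simp only [intVec_apply, one_mul]
      rw [← two_mul] at hs
      exact_mod_cast hs
    · refine ⟨Or.inr fun i => ?_, s, ?_⟩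
      · obtain ⟨a, ha⟩ := ho i
        refine ⟨a, ?_⟩
        rw [intVec_apply, ha]
        push_cast
        ring
      · simp only [intVec_apply, ← Finset.mul_sum]
        rw [← Int.cast_sum, hs]
        push_cast
        ring

/-- An integral vector of even sum has even square norm, so at least 2 if nonzero; a half-integral
one has eight entries of square at least `1/4`. -/
theorem hasLeastLength_latticeE8 : HasLeastLength latticeE8 √2 := by
  refine hasLeastLength_of_sq (Real.sqrt_nonneg 2) ?_ (x := intVec (1 / 2) 1) ?_ ?_ ?_
  · intro x hx hx0
    rw [Real.sq_sqrt (by norm_num)]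
    rcases mem_latticeE8_iff.mp hx with ⟨v, he, rfl⟩ | ⟨v, ho, -, rfl⟩
    · have hv : v ≠ 0 := by
        rintro rfl
        exact hx0 (intVec_zero 1)
      have : (2 : ℝ) ≤ (∑ i, v i ^ 2 : ℤ) := by exact_mod_cast two_le_sum_sq hv he
      rw [sum_intVec_sq]
      linarith
    · have h := card_filter_odd_le_sum_sq v
      rw [Finset.filter_true_of_mem fun i _ => ho i, Finset.card_univ, Fintype.card_fin] at h
      have : (8 : ℝ) ≤ (∑ i, v i ^ 2 : ℤ) := by exact_mod_cast h
      rw [sum_intVec_sq]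
      linarith
  · exact mem_latticeE8_iff.mpr (Or.inr ⟨1, fun i => odd_one, by simp, rfl⟩)
  · intro h
    have := congrArg (fun x : Euc 8 => x 0) h
    simp at this
  · rw [sum_intVec_sq, Real.sq_sqrt (by norm_num)]
    norm_num

theorem minimalVectors_latticeE8 : minimalVectors latticeE8 =
    intVec 1 '' {v | ∑ i, v i ^ 2 = 2} ∪
    intVec (1 / 2) '' {v | Finset.univ.filter (fun i => Odd (v i)) ∈ ({Finset.univ} : Finset _) ∧
      ∑ i, v i ^ 2 = (8 : ℕ) ∧ 4 ∣ ∑ i, v i} := by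
  rw [hasLeastLength_latticeE8.minimalVectors_eq]
  ext x
  rw [Set.mem_ofPred_eq, norm_eq_iff_sum_sq (Real.sqrt_nonneg 2), Real.sq_sqrt (by norm_num)]
  constructor
  · rintro ⟨hx, hn⟩
    rcases mem_latticeE8_iff.mp hx with ⟨v, he, rfl⟩ | ⟨v, ho, h4, rfl⟩
    · refine Or.inl ⟨v, ?_, rfl⟩
      rw [sum_intVec_sq, one_pow, one_mul] at hn
      exact_mod_cast hn
    · refine Or.inr ⟨v, ⟨by simp [ho], ?_, h4⟩, rfl⟩
      rw [sum_intVec_sq] at hn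
      have : ((∑ i, v i ^ 2 : ℤ) : ℝ) = 8 := by linarith
      exact_mod_cast this
  · rintro (⟨v, hv, rfl⟩ | ⟨v, ⟨ho, hv, h4⟩, rfl⟩)
    · have hv' : ∑ i, v i ^ 2 = 2 := hv
      refine ⟨mem_latticeE8_iff.mpr (Or.inl ⟨v, ?_, rfl⟩), ?_⟩
      · rw [← even_sum_sq_iff, hv']
        exact even_two
      · rw [sum_intVec_sq, hv']
        norm_num
    · refine ⟨mem_latticeE8_iff.mpr (Or.inr ⟨v, ?_, h4, rfl⟩), ?_⟩
      · simpa [Finset.filter_eq_self] using ho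
      · rw [sum_intVec_sq, hv]
        norm_num

theorem encard_minimalVectors_latticeE8 : (minimalVectors latticeE8).encard = 240 := by
  rw [minimalVectors_latticeE8, Set.encard_union_eq,
    (intVec_injective one_ne_zero).encard_image, encard_sum_sq_eq_two,
    (intVec_injective (by norm_num)).encard_image,
    encard_odd_support_mem (by norm_num) (by norm_num) (by simp), Fintype.card_fin,
    Finset.card_singleton]
  -- `28 · 4 + 2 ^ 7 = 240`.
  · norm_num [Nat.choose]
  · rw [Set.disjoint_left]
    rintro _ ⟨v, -, rfl⟩ ⟨w, ⟨ho, -⟩, h⟩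
    have h0 := congrArg (fun x : Euc 8 => x 0) h
    have hw : Odd (w 0) := by
      have : Finset.univ.filter (fun i => Odd (w i)) = Finset.univ := by simpa using ho
      exact Finset.filter_eq_self.mp this 0 (Finset.mem_univ _)
    obtain ⟨k, hk⟩ := hw
    simp only [intVec_apply] at h0
    have h1 : ((w 0 : ℤ) : ℝ) = ((2 * v 0 : ℤ) : ℝ) := by
      push_cast
      linarith
    have h2 : w 0 = 2 * v 0 := by exact_mod_cast h1
    omega

theorem kissesWith_sqrt_two_smul_latticeE8 : KissesWith (√2 • latticeE8) 240 := by
  have h2 : (0 : ℝ) < √2 := Real.sqrt_pos.mpr (by norm_num)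
  have h := hasLeastLength_latticeE8.smul h2
  rw [Real.mul_self_sqrt (by norm_num)] at h
  refine ⟨h.isLatticeIn (by norm_num) fun i => ⟨√2 * 2, by positivity, ?_⟩, h,
    h.isKissingConfiguration, ?_⟩
  -- The unit vector `e_i` has odd sum, so `2 e_i` is used.
  · have hm : intVec 1 (Pi.single i 2) ∈ latticeE8 :=
      mem_latticeE8_iff.mpr (Or.inl ⟨_, by simp, rfl⟩)
    have h3 := Submodule.smul_mem_pointwise_smul _ √2 _ hm
    convert h3 using 1
    ext j
    by_cases hj : j = i
    · subst hj
      simp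
    · simp [hj]
  · rw [hasLeastLength_latticeE8.encard_minimalVectors_smul h2, encard_minimalVectors_latticeE8]

/-! ### The extended binary Golay code by enumeration -/

/-- The list of all sums, with respect to bitwise addition, of the words `f k`, `k ∈ l`. -/
def xorSpan (f : ℕ → ℕ) : List ℕ → List ℕ
  | [] => [0]
  | k :: l => xorSpan f l ++ (xorSpan f l).map fun a => f k ^^^ a

/-- The number of nonzero bits among the `n` lowest bits of a natural number. -/
def bitCount : ℕ → ℕ → ℕ
  | 0, _ => 0
  | _ + 1, 0 => 0
  | n + 1, a + 1 => (a + 1) % 2 + bitCount n ((a + 1) / 2)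

theorem bitCount_zero (n : ℕ) : bitCount n 0 = 0 := by
  cases n <;> rfl

theorem bitCount_succ (n a : ℕ) : bitCount (n + 1) a = a % 2 + bitCount n (a / 2) := by
  cases a with
  | zero => simp [bitCount_zero]
  | succ a => rfl

/-- The positions of the nonzero bits among the `n` lowest bits of a natural number. -/
def bitSupport (n a : ℕ) : Finset (Fin n) := Finset.univ.filter fun i => a.testBit i

/-- The characteristic function of a set as a binary word. -/
def binaryWord {n : ℕ} (s : Finset (Fin n)) (i : Fin n) : ZMod 2 := if i ∈ s then 1 else 0

/-- The generators of the extended binary Golay code, as binary numerals. -/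
def golayMask (k : ℕ) : ℕ := 2 ^ 23 + 3189 * 2 ^ k

/-- The words of the extended binary Golay code, as binary numerals. -/
def golayMasks : List ℕ := xorSpan golayMask (List.range 12)

/-- The number of words `b ^^^ a`, for `b` in `xorSpan f l`, that satisfy `p`. -/
def xorCount (p : ℕ → Bool) (f : ℕ → ℕ) : List ℕ → ℕ → ℕ
  | [], a => (p a).toNat
  | k :: l, a => xorCount p f l a + xorCount p f l (f k ^^^ a)

/-- `xorCount` visits the same words with a single accumulator, so counts over all 4096 codewords
can be evaluated without forming the list. -/
theorem xorCount_eq_countP (p : ℕ → Bool) (f : ℕ → ℕ) (l : List ℕ) (a : ℕ) :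
    xorCount p f l a = (xorSpan f l).countP fun b => p (b ^^^ a) := by
  induction l generalizing a with
  | nil =>
    cases h : p a <;> simp [xorCount, xorSpan, h]
  | cons k l ih =>
    rw [xorCount, xorSpan, List.countP_append, List.countP_map, ih, ih]
    congr 2
    funext b
    rw [Function.comp_apply, ← Nat.xor_assoc, Nat.xor_comm b]

theorem golayMasks_weights {a : ℕ} (ha : a ∈ golayMasks) :
    4 ∣ bitCount 24 a ∧ (bitCount 24 a = 0 ∨ 8 ≤ bitCount 24 a) := by
  -- The claim is checked by counting the words that violate it.
  have h : xorCount (fun a => !(bitCount 24 a % 4 == 0 && (bitCount 24 a == 0 ||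
      Nat.ble 8 (bitCount 24 a)))) golayMask (List.range 12) 0 = 0 := by
    decide +kernel
  rw [xorCount_eq_countP, List.countP_eq_zero] at h
  have := h a ha
  simp only [Nat.xor_zero, Bool.not_eq_true', Bool.not_eq_false, Bool.and_eq_true, beq_iff_eq,
    Bool.or_eq_true, Nat.ble_eq] at this
  exact ⟨Nat.dvd_of_mod_eq_zero this.1, this.2⟩

theorem golayMasks_count : (golayMasks.countP fun a => bitCount 24 a = 8) = 759 := by
  have h : xorCount (fun a => bitCount 24 a = 8) golayMask (List.range 12) 0 = 759 := by
    decide +kernel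
  have h' := (xorCount_eq_countP _ _ _ _).symm.trans h
  simp only [Nat.xor_zero] at h'
  exact h'

theorem length_xorSpan (f : ℕ → ℕ) (l : List ℕ) : (xorSpan f l).length = 2 ^ l.length := by
  induction l with
  | nil => rfl
  | cons k l ih => rw [xorSpan, List.length_append, List.length_map, ih, List.length_cons]; ring

theorem testBit_xorSpan {f : ℕ → ℕ} {l : List ℕ} {i : ℕ} (h : ∀ k ∈ l, (f k).testBit i = false)
    {a : ℕ} (ha : a ∈ xorSpan f l) : a.testBit i = false := by
  induction l generalizing a with
  | nil =>
    rw [List.mem_singleton.mp ha, Nat.zero_testBit]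
  | cons k l ih =>
    have ih' := @ih fun j hj => h j (List.mem_cons_of_mem _ hj)
    rcases List.mem_append.mp ha with ha | ha
    · exact ih' ha
    · obtain ⟨b, hb, rfl⟩ := List.mem_map.mp ha
      rw [Nat.testBit_xor, h k List.mem_cons_self, ih' hb]
      rfl

/-- Sums of words in echelon form are distinct. -/
theorem nodup_xorSpan {f : ℕ → ℕ} {l : List ℕ} (h : ∀ k ∈ l, (f k).testBit k)
    (hl : l.Pairwise fun k k' => (f k').testBit k = false) : (xorSpan f l).Nodup := by
  induction l with
  | nil => exact List.nodup_singleton 0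
  | cons k l ih =>
    obtain ⟨hk, hl⟩ := List.pairwise_cons.mp hl
    have ih' := ih (fun j hj => h j (List.mem_cons_of_mem _ hj)) hl
    refine List.Nodup.append ih' (ih'.map (Nat.xor_right_injective)) ?_
    intro a ha ha'
    obtain ⟨b, hb, rfl⟩ := List.mem_map.mp ha'
    have h1 := testBit_xorSpan hk ha
    rw [Nat.testBit_xor, testBit_xorSpan hk hb, h k List.mem_cons_self] at h1
    exact absurd h1 (by decide)

theorem nodup_golayMasks : golayMasks.Nodup :=
  -- The generator polynomial has constant term 1, so the lowest bit of `golayMask k` is bit `k`: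
  -- the rows are in echelon form.
  nodup_xorSpan (by decide +kernel) (by decide +kernel)

theorem lt_of_mem_golayMasks {a : ℕ} (ha : a ∈ golayMasks) : a < 2 ^ 24 := by
  refine Nat.lt_pow_two_of_testBit a fun i hi => testBit_xorSpan (fun k hk => ?_) ha
  have h : golayMask k < 2 ^ 24 := by
    have hk' : 2 ^ k ≤ 2 ^ 11 := Nat.pow_le_pow_right (by norm_num) (by
      have := List.mem_range.mp hk
      omega)
    rw [golayMask]
    omega
  exact Nat.testBit_lt_two_pow (h.trans_le (Nat.pow_le_pow_right (by norm_num) hi))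

theorem card_bitSupport (n a : ℕ) : (bitSupport n a).card = bitCount n a := by
  induction n generalizing a with
  | zero => rfl
  | succ n ih =>
    rw [bitCount_succ, ← ih, bitSupport, bitSupport, Finset.card_filter, Fin.sum_univ_succ,
      Finset.card_filter]
    congr 1
    · rcases Nat.mod_two_eq_zero_or_one a with h | h <;> simp [Nat.testBit_zero, h]
    · simp [Nat.testBit_succ]

theorem bitSupport_injOn (n : ℕ) : Set.InjOn (bitSupport n) {a | a < 2 ^ n} := by
  intro a ha b hb h
  refine Nat.eq_of_testBit_eq fun i => ?_
  by_cases hi : i < n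
  · have := Finset.ext_iff.mp h ⟨i, hi⟩
    simp only [bitSupport, Finset.mem_filter, Finset.mem_univ, true_and] at this
    exact Bool.eq_iff_iff.mpr this
  · have hle : 2 ^ n ≤ 2 ^ i := Nat.pow_le_pow_right (by norm_num) (not_lt.mp hi)
    rw [Nat.testBit_lt_two_pow (lt_of_lt_of_le ha hle),
      Nat.testBit_lt_two_pow (lt_of_lt_of_le hb hle)]

theorem binaryWord_bitSupport_xor (n a b : ℕ) : binaryWord (bitSupport n (a ^^^ b)) =
    binaryWord (bitSupport n a) + binaryWord (bitSupport n b) := by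
  ext i
  simp only [binaryWord, bitSupport, Finset.mem_filter, Finset.mem_univ, true_and,
    Nat.testBit_xor, Pi.add_apply]
  cases a.testBit i <;> cases b.testBit i <;> decide

/-- Scalars are 0 or 1, so adjoining a generator amounts to appending the translate of the list by
it. -/
theorem mem_span_binaryWord_iff {n : ℕ} {f : ℕ → ℕ} {l : List ℕ} {v : Fin n → ZMod 2} :
    v ∈ Submodule.span (ZMod 2) {w | ∃ k ∈ l, binaryWord (bitSupport n (f k)) = w} ↔
      ∃ a ∈ xorSpan f l, binaryWord (bitSupport n a) = v := by
  induction l generalizing v with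
  | nil =>
    have h : binaryWord (bitSupport n 0) = 0 := by
      ext i
      simp [binaryWord, bitSupport]
    simp [xorSpan, h, eq_comm]
  | cons k l ih =>
    have h : {w | ∃ k' ∈ k :: l, binaryWord (bitSupport n (f k')) = w} =
        insert (binaryWord (bitSupport n (f k)))
          {w | ∃ k ∈ l, binaryWord (bitSupport n (f k)) = w} := by
      ext w
      simp [eq_comm]
    rw [h, Submodule.mem_span_insert]
    simp only [ih, xorSpan, List.mem_append, List.mem_map]
    constructor
    · rintro ⟨c, _, ⟨a, ha, rfl⟩, rfl⟩
      obtain rfl | rfl : c = 0 ∨ c = 1 := by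
        revert c
        decide
      · exact ⟨a, Or.inl ha, by simp⟩
      · exact ⟨_, Or.inr ⟨a, ha, rfl⟩, by rw [binaryWord_bitSupport_xor, one_smul]⟩
    · rintro ⟨_, ha | ⟨a, ha, rfl⟩, rfl⟩
      · exact ⟨0, _, ⟨_, ha, rfl⟩, by simp⟩
      · exact ⟨1, _, ⟨a, ha, rfl⟩, by rw [binaryWord_bitSupport_xor, one_smul]⟩

/-- The supports of the words of the extended binary Golay code. -/
def golaySets : Finset (Finset (Fin 24)) := (golayMasks.map (bitSupport 24)).toFinset

theorem binaryWord_injective (n : ℕ) : Function.Injective (binaryWord (n := n)) := by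
  intro s t h
  ext i
  have := congrFun h i
  simp only [binaryWord] at this
  by_cases hs : i ∈ s <;> by_cases ht : i ∈ t <;> simp_all

theorem binaryWord_mem_golayCode_iff {s : Finset (Fin 24)} :
    binaryWord s ∈ golayCode ↔ s ∈ golaySets := by
  have hrow : ∀ k : Fin 12, binaryWord (bitSupport 24 (golayMask k)) = golayRow k := by
    decide +kernel
  have h : Set.range golayRow =
      {w | ∃ k ∈ List.range 12, binaryWord (bitSupport 24 (golayMask k)) = w} := by
    ext w
    constructor
    · rintro ⟨k, rfl⟩
      exact ⟨k, List.mem_range.mpr k.2, hrow k⟩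
    · rintro ⟨k, hk, rfl⟩
      exact ⟨⟨k, List.mem_range.mp hk⟩, (hrow ⟨k, List.mem_range.mp hk⟩).symm⟩
  rw [golayCode, h, mem_span_binaryWord_iff, golaySets, List.mem_toFinset, List.mem_map]
  simp only [(binaryWord_injective 24).eq_iff]
  rfl

theorem nodup_map_bitSupport_golayMasks : (golayMasks.map (bitSupport 24)).Nodup :=
  nodup_golayMasks.map_on fun _ ha _ hb h =>
    bitSupport_injOn 24 (lt_of_mem_golayMasks ha) (lt_of_mem_golayMasks hb) h

theorem card_golaySets : golaySets.card = 4096 := by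
  rw [golaySets, List.toFinset_card_of_nodup nodup_map_bitSupport_golayMasks, List.length_map]
  exact length_xorSpan golayMask (List.range 12)

theorem card_octads : (golaySets.filter fun s => s.card = 8).card = 759 := by
  have h : golaySets.filter (fun s => s.card = 8) =
      ((golayMasks.map (bitSupport 24)).filter fun s => s.card = 8).toFinset := by
    ext s
    simp [golaySets]
  rw [h,
    List.toFinset_card_of_nodup (nodup_map_bitSupport_golayMasks.filter _),
    ← List.countP_eq_length_filter, List.countP_map]
  refine Eq.trans (List.countP_congr fun a _ => ?_) golayMasks_count
  rw [Function.comp_apply, card_bitSupport]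

theorem card_of_mem_golaySets {s : Finset (Fin 24)} (hs : s ∈ golaySets) :
    4 ∣ s.card ∧ (s.card = 0 ∨ 8 ≤ s.card) := by
  obtain ⟨a, ha, rfl⟩ := List.mem_map.mp (List.mem_toFinset.mp hs)
  rw [card_bitSupport]
  exact golayMasks_weights ha

theorem empty_mem_golaySets : ∅ ∈ golaySets := by
  rw [← binaryWord_mem_golayCode_iff]
  exact golayCode.zero_mem

theorem one_mem_golayCode : (1 : Fin 24 → ZMod 2) ∈ golayCode := by
  -- These are the exponents of the reciprocal of the generator polynomial `g`; their product is `1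
  -- + X + ⋯ + X²²`. Seven rows are added, so the parity bit is 1.
  have h : ∑ k ∈ ({0, 1, 5, 6, 7, 9, 11} : Finset (Fin 12)), golayRow k = 1 := by
    decide +kernel
  rw [← h]
  exact Submodule.sum_mem _ fun k _ => Submodule.subset_span ⟨k, rfl⟩

attribute [irreducible] golaySets

theorem intCast_mem_golayCode_iff {w : Fin 24 → ℤ} : (fun i => (w i : ZMod 2)) ∈ golayCode ↔
    Finset.univ.filter (fun i => Odd (w i)) ∈ golaySets := by
  rw [← binaryWord_mem_golayCode_iff]
  have h : (fun i => (w i : ZMod 2)) = binaryWord (Finset.univ.filter fun i => Odd (w i)) := by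
    ext i
    by_cases hi : Odd (w i)
    · simp [binaryWord, hi, (ZMod.intCast_eq_one_iff_odd).mpr hi]
    · simp [binaryWord, hi, (ZMod.intCast_eq_zero_iff_even).mpr (Int.not_odd_iff_even.mp hi)]
  rw [h]

theorem shift_mem_golayCode {w : Fin 24 → ℤ} (h : (fun i => (w i : ZMod 2)) ∈ golayCode) (k : ℤ) :
    (fun i => ((w i + k : ℤ) : ZMod 2)) ∈ golayCode := by
  have h1 := golayCode.add_mem h (golayCode.smul_mem (k : ZMod 2) one_mem_golayCode)
  convert h1 using 1
  ext i
  simp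

/-! ### The Leech lattice -/

/-- The vector with entries `∓1`, negative on the set `p.1`, except for the entry `±3` at `p.2`. -/
def oddVector (p : Finset (Fin 24) × Fin 24) (i : Fin 24) : ℤ :=
  (if i ∈ p.1 then -1 else 1) * if i = p.2 then -3 else 1

theorem oddVector_injective : Function.Injective oddVector := by
  rintro ⟨s, i⟩ ⟨t, j⟩ h
  have h1 : i = j := by
    have := congrFun h i
    simp only [oddVector] at this
    by_contra hij
    simp only [hij, if_true, if_false] at this
    split_ifs at this <;> omega
  have h2 : s = t := by
    ext k
    have := congrFun h k
    simp only [oddVector, h1] at this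
    by_cases hk : k ∈ s <;> by_cases hk' : k ∈ t <;> by_cases hkj : k = j <;> simp_all
  rw [h1, h2]

/-- Since the all-one word is in the code, `m = 2k` or `m = 2k + 1` can be normalised to 0 or 1 by
replacing `w` with `w + k`. -/
theorem mem_leechLattice_iff {x : Euc 24} : x ∈ leechLattice ↔
    (∃ w : Fin 24 → ℤ, Finset.univ.filter (fun i => Odd (w i)) ∈ golaySets ∧ 4 ∣ ∑ i, w i ∧
      intVec (2 / √8) w = x) ∨
    (∃ w : Fin 24 → ℤ, Finset.univ.filter (fun i => Odd (w i)) ∈ golaySets ∧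
      8 ∣ ∑ i, (1 + 2 * w i) - 4 ∧ intVec (1 / √8) (fun i => 1 + 2 * w i) = x) := by
  have h8 : √8 ≠ 0 := by positivity
  constructor
  · rintro ⟨m, w, hw, hs, hx⟩
    have hs' := hs.symm.dvd
    rcases Int.even_or_odd' m with ⟨k, rfl | rfl⟩
    · refine Or.inl ⟨fun i => w i + k, intCast_mem_golayCode_iff.mp (shift_mem_golayCode hw k),
        ?_, ?_⟩
      · have h : ∑ i, (2 * k + 2 * w i) = 2 * ∑ i, (w i + k) := by
          rw [Finset.mul_sum]
          exact Finset.sum_congr rfl fun i _ => by ring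
        rw [h] at hs'
        change 4 ∣ ∑ i, (w i + k)
        omega
      · ext i
        rw [intVec_apply, ← mul_right_inj' h8, hx i]
        push_cast
        field_simp
        ring
    · refine Or.inr ⟨fun i => w i + k, intCast_mem_golayCode_iff.mp (shift_mem_golayCode hw k),
        ?_, ?_⟩
      · have h : ∑ i, (2 * k + 1 + 2 * w i) = ∑ i, (1 + 2 * (w i + k)) :=
          Finset.sum_congr rfl fun i _ => by ring
        rw [h] at hs'
        change 8 ∣ ∑ i, (1 + 2 * (w i + k)) - 4
        omega
      · ext i
        rw [intVec_apply, ← mul_right_inj' h8, hx i]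
        push_cast
        field_simp
        ring
  · rintro (⟨w, hw, hs, rfl⟩ | ⟨w, hw, hs, rfl⟩)
    · refine ⟨0, w, intCast_mem_golayCode_iff.mpr hw, ?_, fun i => ?_⟩
      · simp only [zero_add, ← Finset.mul_sum]
        exact Int.modEq_zero_iff_dvd.mpr (by omega)
      · rw [intVec_apply]
        push_cast
        field_simp
        ring
    · refine ⟨1, w, intCast_mem_golayCode_iff.mpr hw, ?_, fun i => ?_⟩
      · exact (Int.modEq_iff_dvd.mpr (by omega)).symm
      · rw [intVec_apply]
        field_simp

theorem forall_even_or_eight_le_sum_sq {w : Fin 24 → ℤ}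
    (hw : Finset.univ.filter (fun i => Odd (w i)) ∈ golaySets) :
    (∀ i, Even (w i)) ∨ 8 ≤ ∑ i, w i ^ 2 := by
  rcases (card_of_mem_golaySets hw).2 with h | h
  · left
    intro i
    rw [Finset.card_eq_zero, Finset.filter_eq_empty_iff] at h
    exact Int.not_odd_iff_even.mp (h (Finset.mem_univ i))
  · right
    have := card_filter_odd_le_sum_sq w
    omega

/-- After changing signs on the codeword, all entries are `≡ 1 (mod 4)`, so each is `1`, `-3` or of
absolute value at least 5. They cannot all be 1: the original sum would be `24 - 2 |s| ≡ 0 (mod 8)`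
because `4 ∣ |s|`. The least square norm is therefore `23 + 9`, reached only with a single `-3`. -/
theorem exists_eq_oddVector {w : Fin 24 → ℤ} (hw : Finset.univ.filter (fun i => Odd (w i)) ∈ golaySets)
    (hs : 8 ∣ ∑ i, (1 + 2 * w i) - 4) : 32 ≤ ∑ i, (1 + 2 * w i) ^ 2 ∧
    (∑ i, (1 + 2 * w i) ^ 2 = 32 → ∃ i, (fun i => 1 + 2 * w i) =
      oddVector (Finset.univ.filter (fun i => Odd (w i)), i)) := by
  set s := Finset.univ.filter (fun i => Odd (w i)) with hsdef
  have hmem (i : Fin 24) : i ∈ s ↔ Odd (w i) := by simp [hsdef]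
  let u : Fin 24 → ℤ := fun i => (if i ∈ s then -1 else 1) * (1 + 2 * w i)
  have hu4 (i : Fin 24) : u i = 1 ∨ u i = -3 ∨ 25 ≤ u i ^ 2 := by
    have h4 : 4 ∣ u i - 1 := by
      by_cases hi : Odd (w i)
      · simp only [u, hmem, hi, if_true]
        obtain ⟨k, hk⟩ := hi
        omega
      · simp only [u, hmem, hi, if_false]
        obtain ⟨k, hk⟩ := Int.not_odd_iff_even.mp hi
        omega
    obtain h | h | h | h : u i = 1 ∨ u i = -3 ∨ 5 ≤ u i ∨ u i ≤ -7 := by omega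
    · exact Or.inl h
    · exact Or.inr (Or.inl h)
    · exact Or.inr (Or.inr (by nlinarith))
    · exact Or.inr (Or.inr (by nlinarith))
  have hu1 (i : Fin 24) : 0 ≤ u i ^ 2 - 1 := by
    rcases hu4 i with h | h | h
    · rw [h]; norm_num
    · rw [h]; norm_num
    · omega
  have husq (i : Fin 24) : (1 + 2 * w i) ^ 2 = u i ^ 2 := by
    simp only [u]
    split_ifs <;> ring
  have hz (i : Fin 24) : 1 + 2 * w i = (if i ∈ s then -1 else 1) * u i := by
    simp only [u]
    split_ifs <;> ring
  have hsum : ∑ i, (1 + 2 * w i) ^ 2 = 24 + ∑ i, (u i ^ 2 - 1) := by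
    simp [husq]
  have hex : ∃ i, u i ≠ 1 := by
    by_contra! hall
    have h1 : ∑ i, (1 + 2 * w i) = 24 - 2 * s.card := by
      have h2 (i : Fin 24) : 1 + 2 * w i = 1 - 2 * (if i ∈ s then 1 else 0) := by
        rw [hz, hall]
        split_ifs <;> norm_num
      simp only [h2]
      simp [Finset.sum_sub_distrib, mul_comm]
    have := (card_of_mem_golaySets hw).1
    rw [h1] at hs
    omega
  obtain ⟨i, hi⟩ := hex
  have hui : 8 ≤ u i ^ 2 - 1 := by
    rcases hu4 i with h | h | h
    · exact absurd h hi
    · rw [h]; norm_num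
    · omega
  rw [← Finset.add_sum_erase _ (fun i => u i ^ 2 - 1) (Finset.mem_univ i)] at hsum
  have hrest : 0 ≤ ∑ j ∈ Finset.univ.erase i, (u j ^ 2 - 1) :=
    Finset.sum_nonneg fun j _ => hu1 j
  refine ⟨by omega, fun h32 => ⟨i, ?_⟩⟩
  have hui' : u i = -3 := by
    rcases hu4 i with h | h | h
    · exact absurd h hi
    · exact h
    · omega
  have hzero := (Finset.sum_eq_zero_iff_of_nonneg fun j _ => hu1 j).mp
    (show ∑ j ∈ Finset.univ.erase i, (u j ^ 2 - 1) = 0 by omega)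
  ext j
  simp only [oddVector]
  rw [hz]
  congr 1
  split_ifs with hj
  · rw [hj, hui']
  · have := hzero j (Finset.mem_erase.mpr ⟨hj, Finset.mem_univ j⟩)
    rcases hu4 j with h | h | h
    · exact h
    · rw [h] at this
      norm_num at this
    · omega

theorem sum_oddVector_sq (p : Finset (Fin 24) × Fin 24) : ∑ i, oddVector p i ^ 2 = 32 := by
  have h (i : Fin 24) : oddVector p i ^ 2 = 1 + if i = p.2 then 8 else 0 := by
    simp only [oddVector]
    split_ifs <;> norm_num
  simp [h, Finset.sum_add_distrib]

theorem oddVector_mem_leechLattice {s : Finset (Fin 24)} (hs : s ∈ golaySets) (i : Fin 24) :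
    intVec (1 / √8) (oddVector (s, i)) ∈ leechLattice := by
  -- This is `(z - 1) / 2` for `z = oddVector (s, i)`; it is odd exactly on `s`.
  let w : Fin 24 → ℤ := fun j => if j ∈ s then (if j = i then 1 else -1) else
    if j = i then -2 else 0
  have hw : (fun j => 1 + 2 * w j) = oddVector (s, i) := by
    ext j
    simp only [w, oddVector]
    split_ifs <;> norm_num
  have hodd : Finset.univ.filter (fun i => Odd (w i)) = s := by
    ext j
    simp only [w, Finset.mem_filter, Finset.mem_univ, true_and]
    split_ifs <;> simp_all
  refine mem_leechLattice_iff.mpr (Or.inr ⟨w, by rwa [hodd], ?_, by rw [hw]⟩)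
  have h1 (j : Fin 24) : 1 + 2 * w j = 1 - 2 * (if j ∈ s then 1 else 0) -
      (if j = i then (if i ∈ s then -4 else 4) else 0) := by
    simp only [w]
    by_cases hj : j = i
    · subst hj
      split_ifs <;> norm_num
    · simp only [hj, if_false]
      split_ifs <;> norm_num
  have h2 : ∑ j, (1 + 2 * w j) = 24 - 2 * s.card - (if i ∈ s then -4 else 4) := by
    simp only [h1]
    simp [Finset.sum_sub_distrib, mul_comm]
  rw [h2]
  have := (card_of_mem_golaySets hs).1
  split_ifs <;> omega

theorem two_div_sqrt_eight_sq : (2 / √8) ^ 2 = 1 / 2 := by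
  rw [div_pow, Real.sq_sqrt (by norm_num)]
  norm_num

theorem one_div_sqrt_eight_sq : (1 / √8) ^ 2 = 1 / 8 := by
  rw [div_pow, Real.sq_sqrt (by norm_num)]
  norm_num

theorem exists_eq_two_mul {w : Fin 24 → ℤ} (he : ∀ i, Even (w i)) (h4 : 4 ∣ ∑ i, w i) :
    ∃ v : Fin 24 → ℤ, Even (∑ i, v i) ∧ w = (fun i => 2 * v i) := by
  choose v hv using he
  have h : w = fun i => 2 * v i := by
    ext i
    rw [hv, two_mul]
  refine ⟨v, ?_, h⟩
  simp only [h, ← Finset.mul_sum] at h4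
  rw [Int.even_iff]
  omega

theorem hasLeastLength_leechLattice : HasLeastLength leechLattice 2 := by
  refine hasLeastLength_of_sq (by norm_num) ?_
    (oddVector_mem_leechLattice empty_mem_golaySets 0) ?_ ?_
  · intro x hx hx0
    rcases mem_leechLattice_iff.mp hx with ⟨w, hw, hs, rfl⟩ | ⟨w, hw, hs, rfl⟩
    · rw [sum_intVec_sq, two_div_sqrt_eight_sq]
      have : 8 ≤ ∑ i, w i ^ 2 := by
        -- With no odd entry, `w = 2v` with `v` nonzero of even sum, so `∑ w_i² = 4 ∑ v_i² ≥ 8`;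
        -- otherwise at least eight entries are odd.
        rcases forall_even_or_eight_le_sum_sq hw with h | h
        · obtain ⟨v, hv, rfl⟩ := exists_eq_two_mul h hs
          have hv0 : v ≠ 0 := by
            rintro rfl
            refine hx0 ?_
            ext i
            simp
          have := two_le_sum_sq hv0 hv
          simp only [mul_pow, ← Finset.mul_sum]
          omega
        · exact h
      have : (8 : ℝ) ≤ (∑ i, w i ^ 2 : ℤ) := by exact_mod_cast this
      linarith
    · rw [sum_intVec_sq, one_div_sqrt_eight_sq]
      have : (32 : ℝ) ≤ (∑ i, (1 + 2 * w i) ^ 2 : ℤ) := by exact_mod_cast (exists_eq_oddVector hw hs).1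
      linarith
  · intro h
    have := congrArg (fun x : Euc 24 => x 1) h
    simp [oddVector] at this
  · rw [sum_intVec_sq, one_div_sqrt_eight_sq, sum_oddVector_sq]
    norm_num

/-- In terms of `z = √8 x`, the three shapes are `(±4², 0²²)`, `(±2⁸, 0¹⁶)` supported on an octad,
and `(∓3, ±1²³)`. -/
theorem minimalVectors_leechLattice : minimalVectors leechLattice =
    (intVec (4 / √8) '' {v | ∑ i, v i ^ 2 = 2} ∪
    intVec (2 / √8) '' {v | Finset.univ.filter (fun i => Odd (v i)) ∈
        golaySets.filter (fun s => s.card = 8) ∧ ∑ i, v i ^ 2 = (8 : ℕ) ∧ 4 ∣ ∑ i, v i}) ∪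
    (fun p => intVec (1 / √8) (oddVector p)) ''
      ((golaySets ×ˢ Finset.univ : Finset (Finset (Fin 24) × Fin 24)) : Set _) := by
  have hdouble (v : Fin 24 → ℤ) : intVec (2 / √8) (fun i => 2 * v i) = intVec (4 / √8) v := by
    ext i
    simp only [intVec_apply]
    push_cast
    ring
  rw [hasLeastLength_leechLattice.minimalVectors_eq]
  ext x
  rw [Set.mem_ofPred_eq, norm_eq_iff_sum_sq (by norm_num)]
  constructor
  · rintro ⟨hx, hn⟩
    rcases mem_leechLattice_iff.mp hx with ⟨w, hw, hs, rfl⟩ | ⟨w, hw, hs, rfl⟩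
    · left
      rw [sum_intVec_sq, two_div_sqrt_eight_sq] at hn
      have hn8 : ∑ i, w i ^ 2 = 8 := by
        have : ((∑ i, w i ^ 2 : ℤ) : ℝ) = 8 := by linarith
        exact_mod_cast this
      rcases (card_of_mem_golaySets hw).2 with h | h
      · left
        rw [Finset.card_eq_zero, Finset.filter_eq_empty_iff] at h
        obtain ⟨v, hv, rfl⟩ := exists_eq_two_mul (w := w)
          (fun i => Int.not_odd_iff_even.mp (h (Finset.mem_univ i))) hs
        refine ⟨v, ?_, (hdouble v).symm⟩
        simp only [mul_pow, ← Finset.mul_sum] at hn8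
        rw [Set.mem_ofPred_eq]
        omega
      · right
        have := card_filter_odd_le_sum_sq w
        exact ⟨w, ⟨Finset.mem_filter.mpr ⟨hw, by omega⟩, hn8, hs⟩, rfl⟩
    · right
      rw [sum_intVec_sq, one_div_sqrt_eight_sq] at hn
      have hn32 : ∑ i, (1 + 2 * w i) ^ 2 = 32 := by
        have : ((∑ i, (1 + 2 * w i) ^ 2 : ℤ) : ℝ) = 32 := by linarith
        exact_mod_cast this
      obtain ⟨i, hi⟩ := (exists_eq_oddVector hw hs).2 hn32
      refine ⟨(_, i), ?_, by rw [hi]⟩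
      rw [Finset.mem_coe, Finset.mem_product]
      exact ⟨hw, Finset.mem_univ _⟩
  · rintro ((⟨v, hv, rfl⟩ | ⟨v, ⟨ho, hv, h4⟩, rfl⟩) | ⟨⟨s, i⟩, hp, rfl⟩)
    · have hv' : ∑ i, v i ^ 2 = 2 := hv
      have hev : Even (∑ i, v i) := by
        rw [← even_sum_sq_iff, hv']
        exact even_two
      rw [← hdouble]
      refine ⟨mem_leechLattice_iff.mpr (Or.inl ⟨_, ?_, ?_, rfl⟩), ?_⟩
      · rw [Finset.filter_eq_empty_iff.mpr fun i _ => by simp]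
        exact empty_mem_golaySets
      · rw [← Finset.mul_sum]
        obtain ⟨k, hk⟩ := hev
        omega
      · rw [sum_intVec_sq, two_div_sqrt_eight_sq]
        simp only [mul_pow, ← Finset.mul_sum, hv']
        norm_num
    · refine ⟨mem_leechLattice_iff.mpr (Or.inl ⟨v, (Finset.mem_filter.mp ho).1, h4, rfl⟩), ?_⟩
      rw [sum_intVec_sq, two_div_sqrt_eight_sq, hv]
      norm_num
    · rw [Finset.mem_coe, Finset.mem_product] at hp
      refine ⟨oddVector_mem_leechLattice hp.1 i, ?_⟩
      rw [sum_intVec_sq, one_div_sqrt_eight_sq, sum_oddVector_sq]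
      norm_num

theorem encard_minimalVectors_leechLattice :
    (minimalVectors leechLattice).encard = 196560 := by
  have h8 : √8 ≠ 0 := by positivity
  rw [minimalVectors_leechLattice, Set.encard_union_eq, Set.encard_union_eq,
    (intVec_injective (by positivity)).encard_image, encard_sum_sq_eq_two,
    (intVec_injective (by positivity)).encard_image,
    encard_odd_support_mem (by norm_num) (by norm_num) fun s hs => (Finset.mem_filter.mp hs).2,
    (show Function.Injective fun p => intVec (1 / √8) (oddVector p) from
      (intVec_injective (by positivity)).comp oddVector_injective).encard_image,
    Set.encard_coe_eq_coe_finsetCard, Finset.card_product, Fintype.card_fin, Finset.card_univ,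
    Fintype.card_fin, card_octads, card_golaySets]
  -- `276 · 4 + 759 · 2 ^ 7 + 4096 · 24 = 1104 + 97152 + 98304 = 196560`.
  · norm_num [Nat.choose]
  · rw [Set.disjoint_left]
    rintro _ ⟨v, -, rfl⟩ ⟨w, ⟨ho, -⟩, h⟩
    obtain ⟨i, hi⟩ : (Finset.univ.filter fun i => Odd (w i)).Nonempty := by
      rw [← Finset.card_pos, (Finset.mem_filter.mp ho).2]
      norm_num
    obtain ⟨k, hk⟩ := (Finset.mem_filter.mp hi).2
    have h0 := congrArg (fun x : Euc 24 => x i) h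
    simp only [intVec_apply] at h0
    field_simp at h0
    have h2 : 2 * w i = 4 * v i := by exact_mod_cast h0
    omega
  · rw [Set.disjoint_left]
    have key (v : Fin 24 → ℤ) (p : Finset (Fin 24) × Fin 24)
        (h : intVec (1 / √8) (oddVector p) = intVec (2 / √8) v) : False := by
      have h0 := congrArg (fun x : Euc 24 => x 0) h
      simp only [intVec_apply] at h0
      field_simp at h0
      have h2 : oddVector p 0 = 2 * v 0 := by exact_mod_cast h0
      simp only [oddVector] at h2
      split_ifs at h2 <;> omega
    rintro _ (⟨v, -, rfl⟩ | ⟨v, -, rfl⟩) ⟨p, -, h⟩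
    · refine key (fun i => 2 * v i) p (h.trans ?_)
      ext i
      simp only [intVec_apply]
      push_cast
      ring
    · exact key v p h

theorem kissesWith_leechLattice : KissesWith leechLattice 196560 := by
  have h := hasLeastLength_leechLattice
  refine ⟨h.isLatticeIn (by norm_num) fun i => ⟨2 / √8 * 4, by positivity, ?_⟩, h,
    h.isKissingConfiguration, encard_minimalVectors_leechLattice⟩
  -- The vector `8 e_i / √8`: no odd entry in `w`, and a sum divisible by 4.
  refine mem_leechLattice_iff.mpr (Or.inl ⟨Pi.single i 4, ?_, by simp, ?_⟩)
  · convert empty_mem_golaySets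
    refine Finset.filter_eq_empty_iff.mpr fun j _ => ?_
    by_cases hj : j = i
    · subst hj
      simp only [Pi.single_eq_same]
      decide
    · simp [hj]
  · ext j
    by_cases hj : j = i
    · subst hj
      simp
    · simp [hj]

theorem mainTheorem1 :
    (kissingNumber 8 = 240 ∧ latticeKissingNumber 8 = 240 ∧
      HasLeastLength latticeE8 √2 ∧ (minimalVectors latticeE8).encard = 240 ∧
      KissesWith (√2 • latticeE8) 240) ∧
    (kissingNumber 24 = 196560 ∧ latticeKissingNumber 24 = 196560 ∧
      KissesWith leechLattice 196560) :=
  ⟨⟨kissesWith_sqrt_two_smul_latticeE8.kissingNumber_eq kissingNumber_eight_le,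
      kissesWith_sqrt_two_smul_latticeE8.latticeKissingNumber_eq kissingNumber_eight_le,
      hasLeastLength_latticeE8, encard_minimalVectors_latticeE8,
      kissesWith_sqrt_two_smul_latticeE8⟩,
    kissesWith_leechLattice.kissingNumber_eq kissingNumber_twentyFour_le,
    kissesWith_leechLattice.latticeKissingNumber_eq kissingNumber_twentyFour_le,
    kissesWith_leechLattice⟩
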